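/- Let $\mathbb D$ be the open unit disc, $dA=\pi^{-1}\,dx\,dy$ the normalized area measure on $\mathbb D$, and $H^\infty$ the space of bounded analytic functions on $\mathbb D$ with $\|f\|_{H^\infty}=\sup_{z\in\mathbb D}|f(z)|$. For a positive Borel measure $\mu$ on $\mathbb D$ put $$U_\mu(z)=\int_{\mathbb D}\log\left|\frac{1-\overline{w}z}{z-w}\right|^2d\mu(w)\in[0,\infty],\qquad z\in\mathbb D,$$ where the integrand is $+\infty$ for $w=z$, and let $M(\mathcal D_\mu)$ be the space of all analytic functions $f$ on $\mathbb D$ such that $$\|f\|_{M(\mathcal D_\mu)}=|f(0)|+\sup_{\phi\in\mathrm{Aut}(\mathbb D)}\left(\int_{\mathbb D}|f'(w)|^2\,U_\mu(\phi(w))\,dA(w)\right)^{1/2}<\infty,$$ where $\mathrm{Aut}(\mathbb D)$ is the group of one-to-one analytic maps of $\mathbb D$ onto itself. For $f(z)=\sum_{n\ge0}a_nz^n$ analytic in $\mathbb D$ let $$\mathcal C(f)(z)=\sum_{n=0}^\infty\frac1{n+1}\left(\sum_{k=0}^na_k\right)z^n$$ be the Cesàro operator. **Theorem.** Let $\mu$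 be a positive Borel measure on $\mathbb D$ that is radial, i.e. invariant under all rotations $z\mapsto\lambda z$, $|\lambda|=1$. If $\mathcal C:H^\infty\to M(\mathcal D_\mu)$ is bounded, then its operator norm $\sup_{\|f\|_{H^\infty}\le1}\|\mathcal C(f)\|_{M(\mathcal D_\mu)}$ is $$\|\mathcal C\|_{H^\infty\to M(\mathcal D_\mu)}=1+\left(\int_{\mathbb D}\frac{4}{|1-z^2|^2}\,U_\mu(z)\,dA(z)\right)^{1/2};$$ in particular the integral is finite. -/

import Mathlib

open MeasureTheory
open scoped ENNReal NNReal

noncomputable section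

namespace CesaroNorm

/-- The open unit disc `𝔻` of the complex plane. -/
def disc : Set ℂ := Metric.ball 0 1

/-- `f` is analytic in the unit disc. Functions are total on `ℂ`; only their values on the disc
are ever used. -/
def Hol (f : ℂ → ℂ) : Prop := DifferentiableOn ℂ f disc

/-- The normalized area measure `dA = π⁻¹ dx dy` on the unit disc. -/
def areaMeasure : Measure ℂ := ENNReal.ofReal Real.pi⁻¹ • (volume.restrict disc)

/-- The automorphisms of the disc: the one-to-one analytic maps of the disc onto itself. -/
def IsAut (φ : ℂ → ℂ) : Prop := Hol φ ∧ Set.BijOn φ disc disc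

/-- A Borel measure is radial if it is invariant under all rotations about the origin. -/
def IsRadial (μ : Measure ℂ) : Prop :=
  ∀ lam : ℂ, ‖lam‖ = 1 → μ.map (fun z => lam * z) = μ

open Classical in
/-- The kernel `log |(1 - w̄ z) / (z - w)|²`. It is positive on the disc, and equal to `+∞` on the
diagonal. -/
def greenKernel (z w : ℂ) : ℝ≥0∞ :=
  if z = w then ⊤
  else ENNReal.ofReal (Real.log (‖(1 - (starRingEnd ℂ) w * z) / (z - w)‖ ^ 2))

/-- The superharmonic potential `U_μ(z) = ∫_𝔻 log |(1 - w̄ z) / (z - w)|² dμ(w)`. -/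
def potential (μ : Measure ℂ) (z : ℂ) : ℝ≥0∞ := ∫⁻ w in disc, greenKernel z w ∂μ

/-- The norm `|f(0)| + sup_φ (∫_𝔻 |f'|² U_μ(φ) dA)^{1/2}` of `M(𝒟_μ)`, the supremum being over all
automorphisms `φ` of the disc, with value `+∞` allowed. -/
def normM (μ : Measure ℂ) (f : ℂ → ℂ) : ℝ≥0∞ :=
  ‖f 0‖ₑ + ⨆ φ : {φ : ℂ → ℂ // IsAut φ},
    (∫⁻ w, ‖deriv f w‖ₑ ^ 2 * potential μ (φ.1 w) ∂areaMeasure) ^ (1 / 2 : ℝ)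

/-- Membership in the conformally invariant Dirichlet space `M(𝒟_μ)`. -/
def MemM (μ : Measure ℂ) (f : ℂ → ℂ) : Prop := Hol f ∧ normM μ f < ⊤

/-- The supremum norm over the disc, with value `+∞` allowed. -/
def normHInf (f : ℂ → ℂ) : ℝ≥0∞ := ⨆ z ∈ disc, ‖f z‖ₑ

/-- Membership in `H^∞`. -/
def MemHInf (f : ℂ → ℂ) : Prop := Hol f ∧ normHInf f < ⊤

/-- The `k`-th Taylor coefficient at the origin. -/
def taylorCoeff (f : ℂ → ℂ) (k : ℕ) : ℂ := iteratedDeriv k f 0 / (k.factorial : ℂ)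

/-- The Cesàro operator `C(f)(z) = ∑ₙ (1/(n+1)) (∑_{k ≤ n} aₖ) zⁿ`, where `f(z) = ∑ₙ aₙ zⁿ`. For `f`
analytic in the disc, the series converges absolutely at every point of the disc. -/
def cesaro (f : ℂ → ℂ) (z : ℂ) : ℂ :=
  ∑' n : ℕ, (1 / ((n : ℂ) + 1)) * (∑ k ∈ Finset.range (n + 1), taylorCoeff f k) * z ^ n

/-- The operator `T` maps `H^∞` boundedly into `M(𝒟_μ)`. -/
def IsBoundedOp (μ : Measure ℂ) (T : (ℂ → ℂ) → (ℂ → ℂ)) : Prop :=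
  ∃ K : ℝ≥0, ∀ f : ℂ → ℂ, MemHInf f → MemM μ (T f) ∧ normM μ (T f) ≤ (K : ℝ≥0∞) * normHInf f

/-- The operator norm of `T : H^∞ → M(𝒟_μ)`: the supremum of `‖T f‖` over the closed unit ball
of `H^∞`. -/
def opNorm (μ : Measure ℂ) (T : (ℂ → ℂ) → (ℂ → ℂ)) : ℝ≥0∞ :=
  ⨆ f : {f : ℂ → ℂ // Hol f ∧ normHInf f ≤ 1}, normM μ (T f.1)

end CesaroNorm

end

namespace CesaroNorm

open Complex Set Filter Topology

local notation "conj" => starRingEnd ℂ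

/-! Upper bound. With `g = cesaro f` and `h z = z * g z`, one has `h' = f / (1 - z)`. Passing from
`g` to `h` cannot decrease any of the Dirichlet integrals. By Tonelli it is enough to check this for
one Green kernel. After a change of variables the Littlewood–Paley identity turns the integral of
`|g'|²` against that kernel into `‖G‖² - |G 0|²` in `H²`, where `G` is `g` composed with an
automorphism `ψ`. For `h` the function is `ψ G`, whose `H²` norm is not smaller and whose value at
`0` is not larger in modulus. Hence `|f| ≤ 1` reduces everything to integrating `1 / |1 - w|²`
against `U_μ ∘ φ`.

Substituting `w = ψ z`, with `ψ` the inverse of `φ`, gives `|ψ' / (1 - ψ)|²` against `U_μ`, and `ψ'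
/ (1 - ψ) = k / (1 - k z) - d / (1 - d z)` with `|k| = 1` and `|d| < 1`. As `U_μ` is radial, only
circle means matter. Parseval and geometric series show that they are largest for `k = 1`, `d = -1`,
where the function is `2 / (1 - z²)` (`lintegral_two_poles_le`).

Lower bound. The constant `1` suffices: `(cesaro 1)'` behaves like `1 / (1 - w)` at `1`, and the
automorphisms `(z + t) / (1 + t z)` push the disc to that point as `t → 1`, so Fatou's lemma
recovers the extremal integral (`le_normM_cesaro_one`).

Boundedness of the operator serves to make `μ` σ-finite on the disc, as Tonelli requires; the
equality is then proved in `[0, ∞]`. -/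

lemma mem_disc {z : ℂ} : z ∈ disc ↔ ‖z‖ < 1 := by simp [disc]

lemma isOpen_disc : IsOpen disc := Metric.isOpen_ball

lemma zero_mem_disc : (0 : ℂ) ∈ disc := by simp [mem_disc]

/-! ### Möbius maps of the disc. -/

/-- The Möbius automorphism `z ↦ η (z - a) / (1 - ā z)` of the disc. -/
noncomputable def mob (η a z : ℂ) : ℂ := η * ((z - a) / (1 - conj a * z))

lemma one_sub_mul_ne_zero {a z : ℂ} (ha : ‖a‖ < 1) (hz : ‖z‖ ≤ 1) : 1 - a * z ≠ 0 := by
  intro h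
  have h1 : ‖a * z‖ = 1 := by rw [← sub_eq_zero.mp h]; simp
  rw [norm_mul] at h1
  nlinarith [norm_nonneg a, norm_nonneg z]

lemma one_sub_conj_mul_ne_zero {a z : ℂ} (ha : ‖a‖ < 1) (hz : ‖z‖ ≤ 1) :
    1 - conj a * z ≠ 0 :=
  one_sub_mul_ne_zero (by simpa using ha) hz

lemma norm_sq_one_sub_conj_mul_sub (a z : ℂ) :
    ‖1 - conj a * z‖ ^ 2 - ‖z - a‖ ^ 2 = (1 - ‖a‖ ^ 2) * (1 - ‖z‖ ^ 2) := by
  simp only [← Complex.normSq_eq_norm_sq, Complex.normSq_apply]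
  simp
  ring

lemma norm_mob {η a z : ℂ} (hη : ‖η‖ = 1) :
    ‖mob η a z‖ = ‖z - a‖ / ‖1 - conj a * z‖ := by
  simp [mob, hη]

lemma one_sub_norm_mob_sq {η a z : ℂ} (hη : ‖η‖ = 1) (ha : ‖a‖ < 1) (hz : ‖z‖ ≤ 1) :
    1 - ‖mob η a z‖ ^ 2 = (1 - ‖a‖ ^ 2) * (1 - ‖z‖ ^ 2) / ‖1 - conj a * z‖ ^ 2 := by
  have h := one_sub_conj_mul_ne_zero ha hz
  have h' : ‖1 - conj a * z‖ ≠ 0 := by simpa using h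
  rw [norm_mob hη, ← norm_sq_one_sub_conj_mul_sub, div_pow, eq_div_iff (pow_ne_zero 2 h'),
    sub_mul, div_mul_cancel₀ _ (pow_ne_zero 2 h'), one_mul]

lemma mob_mem_disc {η a z : ℂ} (hη : ‖η‖ = 1) (ha : ‖a‖ < 1) (hz : z ∈ disc) :
    mob η a z ∈ disc := by
  rw [mem_disc] at *
  have h := one_sub_conj_mul_ne_zero ha hz.le
  have h' : 0 < ‖1 - conj a * z‖ := by simpa using h
  have h1 := one_sub_norm_mob_sq hη ha hz.le
  have h2 : 0 < (1 - ‖a‖ ^ 2) * (1 - ‖z‖ ^ 2) / ‖1 - conj a * z‖ ^ 2 := by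
    have : 0 < 1 - ‖a‖ ^ 2 := by nlinarith [norm_nonneg a]
    have : 0 < 1 - ‖z‖ ^ 2 := by nlinarith [norm_nonneg z]
    positivity
  by_contra h3
  nlinarith [norm_nonneg (mob η a z)]

lemma mul_conj_of_norm_eq_one {η : ℂ} (hη : ‖η‖ = 1) : η * conj η = 1 := by
  rw [Complex.mul_conj, Complex.normSq_eq_norm_sq, hη]; simp

lemma one_sub_mul_conj_ne_zero {a : ℂ} (ha : ‖a‖ < 1) : 1 - a * conj a ≠ 0 :=
  one_sub_mul_ne_zero ha (by simpa using ha.le)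

lemma mob_mob {η a z : ℂ} (hη : ‖η‖ = 1) (ha : ‖a‖ < 1) (hz : z ∈ disc) :
    mob (conj η) (-(η * a)) (mob η a z) = z := by
  have h := one_sub_conj_mul_ne_zero ha (mem_disc.mp hz).le
  have h1 := mul_conj_of_norm_eq_one hη
  have h2 := one_sub_mul_conj_ne_zero ha
  have hη0 : η ≠ 0 := by rintro rfl; simp at hη
  have key : 1 + conj a * ((z - a) / (1 - conj a * z)) = (1 - a * conj a) / (1 - conj a * z) := by
    field_simp; ring
  have hd : 1 - conj (-(η * a)) * mob η a z = (1 - a * conj a) / (1 - conj a * z) := by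
    rw [← key, mob]; simp only [map_neg, map_mul]
    linear_combination conj a * ((z - a) / (1 - conj a * z)) * h1
  have hn : mob η a z - -(η * a) = η * ((1 - a * conj a) * z / (1 - conj a * z)) := by
    have : (z - a) / (1 - conj a * z) + a = (1 - a * conj a) * z / (1 - conj a * z) := by
      rw [div_add' _ _ _ h]; congr 1; ring
    rw [mob]; linear_combination η * this
  rw [mob, hd, hn]
  field_simp
  linear_combination z * h1

lemma mob_mob' {η a z : ℂ} (hη : ‖η‖ = 1) (ha : ‖a‖ < 1) (hz : z ∈ disc) :
    mob η a (mob (conj η) (-(η * a)) z) = z := by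
  have h := mob_mob (η := conj η) (a := -(η * a)) (by simpa using hη) (by simpa [hη] using ha) hz
  have h1 := mul_conj_of_norm_eq_one hη
  have h2 : -(conj η * -(η * a)) = a := by linear_combination a * h1
  rwa [h2, Complex.conj_conj] at h

lemma hasDerivAt_mob {η a z : ℂ} (ha : ‖a‖ < 1) (hz : z ∈ disc) :
    HasDerivAt (mob η a) (η * (1 - a * conj a) / (1 - conj a * z) ^ 2) z := by
  have h := one_sub_conj_mul_ne_zero ha (mem_disc.mp hz).le
  have h1 : HasDerivAt (fun z : ℂ => z - a) 1 z := (hasDerivAt_id z).sub_const a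
  have h2 : HasDerivAt (fun z : ℂ => 1 - conj a * z) (-conj a) z := by
    simpa using ((hasDerivAt_id z).const_mul (conj a)).const_sub 1
  have h3 := (h1.div h2 h).const_mul η
  convert! h3 using 1
  field_simp; ring

lemma hol_mob {η a : ℂ} (ha : ‖a‖ < 1) : Hol (mob η a) := fun _ hz =>
  (hasDerivAt_mob ha hz).differentiableAt.differentiableWithinAt

lemma isAut_mob {η a : ℂ} (hη : ‖η‖ = 1) (ha : ‖a‖ < 1) : IsAut (mob η a) := by
  refine ⟨hol_mob ha, fun z hz => mob_mem_disc hη ha hz, ?_, ?_⟩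
  · intro z hz w hw h
    rw [← mob_mob hη ha hz, h, mob_mob hη ha hw]
  · intro z hz
    exact ⟨_, mob_mem_disc (by simpa using hη) (by simpa [hη] using ha) hz, mob_mob' hη ha hz⟩

lemma IsAut.comp {φ ψ : ℂ → ℂ} (hφ : IsAut φ) (hψ : IsAut ψ) : IsAut (φ ∘ ψ) :=
  ⟨hφ.1.comp hψ.1 hψ.2.mapsTo, hφ.2.comp hψ.2⟩

/-! ### Classification of the automorphisms. -/

/-- An automorphism of the disc maps points near the boundary to points near the boundary. -/
lemma IsAut.exists_lt_norm {φ : ℂ → ℂ} (hφ : IsAut φ) {ρ : ℝ} (hρ : ρ < 1) :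
    ∃ r : ℝ, 0 < r ∧ r < 1 ∧ ∀ z ∈ disc, r ≤ ‖z‖ → ρ < ‖φ z‖ := by
  obtain ⟨hol, hbij⟩ := hφ
  have han : AnalyticOnNhd ℂ φ disc := hol.analyticOnNhd isOpen_disc
  have hopen : ∀ s ⊆ disc, IsOpen s → IsOpen (φ '' s) := by
    rcases han.is_constant_or_isOpen (convex_ball _ _).isPreconnected with ⟨w, hw⟩ | h
    · exfalso
      have h0 : (0 : ℂ) = 1 / 2 := hbij.injOn zero_mem_disc (by simp [mem_disc]; norm_num)
        ((hw _ zero_mem_disc).trans (hw _ (by simp [mem_disc]; norm_num)).symm)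
      norm_num at h0
    · exact h
  have hsub : ∀ r : Ioo (0 : ℝ) 1, Metric.ball (0 : ℂ) r ⊆ disc := fun r =>
    Metric.ball_subset_ball r.2.2.le
  have : Nonempty (Ioo (0 : ℝ) 1) := ⟨⟨1 / 2, by norm_num⟩⟩
  -- The images of the balls of radius `r < 1` are open, increase with `r` and cover the compact
  -- ball of radius `ρ`, so one of them contains it. Injectivity then keeps all other points out of
  -- that ball.
  obtain ⟨r, hr⟩ := (isCompact_closedBall (0 : ℂ) ρ).elim_directed_cover
    (fun r : Ioo (0 : ℝ) 1 => φ '' Metric.ball 0 r)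
    (fun r => hopen _ (hsub r) Metric.isOpen_ball)
    (by
      intro w hw
      have hw' : w ∈ disc := by
        rw [mem_disc]; exact (by simpa using hw : ‖w‖ ≤ ρ).trans_lt hρ
      obtain ⟨z, hz, rfl⟩ := hbij.surjOn hw'
      obtain ⟨r, hr1, hr2⟩ := exists_between (mem_disc.mp hz)
      refine mem_iUnion.mpr ⟨⟨r, (norm_nonneg z).trans_lt hr1, hr2⟩, z, by simpa using hr1, rfl⟩)
    (by
      intro r s
      refine ⟨max r s, image_mono (Metric.ball_subset_ball ?_),
        image_mono (Metric.ball_subset_ball ?_)⟩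
      · exact_mod_cast le_max_left r s
      · exact_mod_cast le_max_right r s)
  refine ⟨r, r.2.1, r.2.2, fun z hz hrz => ?_⟩
  by_contra hcon
  obtain ⟨w, hw, hwz⟩ := hr (by simpa using not_lt.mp hcon : φ z ∈ Metric.closedBall (0 : ℂ) ρ)
  have := hbij.injOn (hsub r hw) hz hwz
  subst this
  have : ‖w‖ < r := by simpa using hw
  linarith

/-- Maximum principle on balls of radius tending to `1`; no boundary values of `Q` are needed. -/
lemma norm_le_one_of_forall_boundary {Q : ℂ → ℂ} (hQ : Hol Q)
    (h : ∀ C : ℝ, 1 < C → ∃ r : ℝ, r < 1 ∧ ∀ z ∈ disc, r ≤ ‖z‖ → ‖Q z‖ ≤ C)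
    {z : ℂ} (hz : z ∈ disc) : ‖Q z‖ ≤ 1 := by
  refine le_of_forall_gt_imp_ge_of_dense fun C hC => ?_
  obtain ⟨r, hr1, hr⟩ := h C hC
  obtain ⟨s, hs1, hs2⟩ := exists_between (max_lt (max_lt hr1 (mem_disc.mp hz)) zero_lt_one)
  simp only [max_lt_iff] at hs1
  have hsub : Metric.closedBall (0 : ℂ) s ⊆ disc := Metric.closedBall_subset_ball hs2
  have hcl : closure (Metric.ball (0 : ℂ) s) = Metric.closedBall 0 s :=
    closure_ball _ hs1.2.ne'
  refine Complex.norm_le_of_forall_mem_frontier_norm_le (U := Metric.ball 0 s)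
    Metric.isBounded_ball ?_ ?_ ?_
  · exact DifferentiableOn.diffContOnCl (hcl ▸ hQ.mono hsub)
  · intro w hw
    rw [frontier_ball _ hs1.2.ne'] at hw
    have : ‖w‖ = s := by simpa using hw
    exact hr w (by rw [mem_disc]; linarith) (by linarith)
  · rw [hcl]; simpa using hs1.1.2.le

/-- Write `φ = P z ^ n` with `P 0 ≠ 0`. By injectivity `P` has no zeros, and since `|φ| → 1` at the
boundary the maximum principle bounds both `P` and `1 / P` by `1`. Thus `P` is a unimodular
constant, and injectivity leaves only `n = 1`. -/
lemma IsAut.eq_mul_of_zero {φ : ℂ → ℂ} (hφ : IsAut φ) (h0 : φ 0 = 0) :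
    ∃ η : ℂ, ‖η‖ = 1 ∧ ∀ z ∈ disc, φ z = η * z := by
  have han : AnalyticOnNhd ℂ φ disc := hφ.1.analyticOnNhd isOpen_disc
  have hne : ∀ z ∈ disc, z ≠ 0 → φ z ≠ 0 := fun z hz hz0 h =>
    hz0 (hφ.2.injOn hz zero_mem_disc (h.trans h0.symm))
  have hnz : ¬ ∀ᶠ z in 𝓝 (0 : ℂ), φ z = 0 := by
    intro h
    have h1 : ∀ᶠ z in 𝓝[≠] (0 : ℂ), φ z = 0 ∧ z ∈ disc ∧ z ≠ 0 :=
      ((h.and (isOpen_disc.eventually_mem zero_mem_disc)).filter_mono nhdsWithin_le_nhds |>.and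
        self_mem_nhdsWithin).mono fun z hz => ⟨hz.1.1, hz.1.2, hz.2⟩
    obtain ⟨z, hz⟩ := h1.exists
    exact hne z hz.2.1 hz.2.2 hz.1
  obtain ⟨n, g, hg, hg0, hfg⟩ :=
    (han 0 zero_mem_disc).exists_eventuallyEq_pow_smul_nonzero_iff.mpr hnz
  simp only [sub_zero, smul_eq_mul] at hfg
  have hn : n ≠ 0 := by
    rintro rfl
    have := hfg.self_of_nhds
    simp [h0] at this
    exact hg0 this.symm
  set P : ℂ → ℂ := Function.update (fun z => φ z / z ^ n) 0 (g 0) with hP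
  have hPg : P =ᶠ[𝓝 0] g := by
    filter_upwards [hfg] with z hz
    rcases eq_or_ne z 0 with rfl | hz0
    · simp [hP]
    · simp [hP, hz0, hz]
  have hPne : ∀ z, z ≠ 0 → P z = φ z / z ^ n := fun z hz => by simp [hP, hz]
  have hPmul : ∀ z, φ z = P z * z ^ n := by
    intro z
    rcases eq_or_ne z 0 with rfl | hz0
    · simp [h0, hn]
    · rw [hPne z hz0]; field_simp
  have hP0 : ∀ z ∈ disc, P z ≠ 0 := by
    intro z hz
    rcases eq_or_ne z 0 with rfl | hz0
    · simpa [hP] using hg0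
    · rw [hPne z hz0]; exact div_ne_zero (hne z hz hz0) (pow_ne_zero _ hz0)
  have hPhol : Hol P := by
    intro z hz
    refine DifferentiableAt.differentiableWithinAt ?_
    rcases eq_or_ne z 0 with rfl | hz0
    · exact hg.differentiableAt.congr_of_eventuallyEq hPg
    · have h1 : DifferentiableAt ℂ (fun z => φ z / z ^ n) z :=
        ((han z hz).differentiableAt).div (by fun_prop) (pow_ne_zero _ hz0)
      refine h1.congr_of_eventuallyEq ?_
      filter_upwards [isOpen_ne.mem_nhds hz0] with w hw
      exact hPne w hw
  have hnormφ : ∀ z ∈ disc, ‖φ z‖ < 1 := fun z hz => mem_disc.mp (hφ.2.mapsTo hz)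
  have hbound : ∀ C : ℝ, 1 < C → ∃ r : ℝ, 0 < r ∧ r < 1 ∧ ∀ z : ℂ, r ≤ ‖z‖ → (‖z‖ ^ n)⁻¹ ≤ C := by
    intro C hC
    have hcont : Tendsto (fun r : ℝ => (r ^ n)⁻¹) (𝓝[<] 1) (𝓝 1) := by
      have : ContinuousAt (fun r : ℝ => (r ^ n)⁻¹) 1 := by
        refine ContinuousAt.inv₀ (by fun_prop) (by simp)
      have h := this.tendsto.mono_left (nhdsWithin_le_nhds (s := Iio 1))
      simpa using h
    obtain ⟨r, hr, hr1⟩ := ((hcont.eventually_lt_const hC).and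
      (Ioo_mem_nhdsLT (zero_lt_one (α := ℝ)))).exists
    refine ⟨r, hr1.1, hr1.2, fun z hz => le_trans ?_ hr.le⟩
    have := hr1.1
    gcongr
  have hP1 : ∀ z ∈ disc, ‖P z‖ ≤ 1 := by
    intro z hz
    refine norm_le_one_of_forall_boundary hPhol (fun C hC => ?_) hz
    obtain ⟨r, hr0, hr1, hr⟩ := hbound C hC
    refine ⟨r, hr1, fun w hw hrw => ?_⟩
    have hw0 : w ≠ 0 := by rintro rfl; simp at hrw; linarith
    rw [hPne w hw0, norm_div, norm_pow, div_eq_mul_inv]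
    calc _ ≤ 1 * (‖w‖ ^ n)⁻¹ := by gcongr; exact (hnormφ w hw).le
      _ ≤ C := by rw [one_mul]; exact hr w hrw
  have hP2 : ∀ z ∈ disc, ‖(P z)⁻¹‖ ≤ 1 := by
    intro z hz
    refine norm_le_one_of_forall_boundary (Q := fun z => (P z)⁻¹) (hPhol.inv hP0)
      (fun C hC => ?_) hz
    obtain ⟨r, hr0, hr1, hr⟩ := hφ.exists_lt_norm (inv_lt_one_of_one_lt₀ hC)
    refine ⟨r, hr1, fun w hw hrw => ?_⟩
    have hw0 : w ≠ 0 := by rintro rfl; simp at hrw; linarith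
    have h1 := hr w hw hrw
    rw [hPne w hw0, norm_inv, norm_div, norm_pow, inv_div]
    have h2 : ‖w‖ ^ n ≤ 1 := pow_le_one₀ (norm_nonneg _) (mem_disc.mp hw).le
    have h3 : 0 < ‖φ w‖ := lt_trans (by positivity) h1
    rw [div_le_iff₀ h3]
    calc ‖w‖ ^ n ≤ 1 := h2
      _ = C * C⁻¹ := by field_simp
      _ ≤ C * ‖φ w‖ := by gcongr
  have hPn : ∀ z ∈ disc, ‖P z‖ = 1 := by
    intro z hz
    refine le_antisymm (hP1 z hz) ?_
    have h1 := hP2 z hz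
    rw [norm_inv] at h1
    exact (inv_le_one₀ (by simpa using hP0 z hz)).mp h1
  have hconst : ∀ z ∈ disc, P z = P 0 := fun z hz =>
    Complex.eqOn_of_isPreconnected_of_isMaxOn_norm (convex_ball _ _).isPreconnected isOpen_disc
      hPhol zero_mem_disc (fun w hw => by
        simp [hPn w hw, hPn 0 zero_mem_disc]) hz
  have hn1 : n = 1 := by
    by_contra hn1
    -- The points `1 / 2` and `ζ / 2` have the same image under `P 0 * z ^ n`, so `ζ = 1`, and its
    -- order `n` is `1`.
    have hζ := Complex.isPrimitiveRoot_exp n hn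
    set ζ := Complex.exp (2 * Real.pi * I / n)
    have hζ1 : ‖ζ‖ = 1 := hζ.norm'_eq_one hn
    have e1 : (1 / 2 : ℂ) ∈ disc := by rw [mem_disc]; norm_num
    have e2 : ζ * (1 / 2 : ℂ) ∈ disc := by rw [mem_disc, norm_mul, hζ1]; norm_num
    have := hφ.2.injOn e2 e1 (by
      rw [hPmul (ζ * (1 / 2)), hPmul (1 / 2), hconst _ e1, hconst _ e2, mul_pow, hζ.pow_eq_one,
        one_mul])
    have h1 : ζ = 1 := by linear_combination 2 * this
    exact hn1 (hζ.eq_orderOf.trans (by rw [h1, orderOf_one]))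
  refine ⟨P 0, hPn 0 zero_mem_disc, fun z hz => ?_⟩
  rw [hPmul z, hconst z hz, hn1, pow_one]

/-- Every automorphism of the disc is a Möbius map. -/
lemma IsAut.exists_eq_mob {φ : ℂ → ℂ} (hφ : IsAut φ) :
    ∃ η a : ℂ, ‖η‖ = 1 ∧ ‖a‖ < 1 ∧ ∀ z ∈ disc, φ z = mob η a z := by
  obtain ⟨a, ha, ha0⟩ := hφ.2.surjOn zero_mem_disc
  have ha' := mem_disc.mp ha
  have h1 : ‖(1 : ℂ)‖ = 1 := norm_one
  have hb : ‖-(1 * a)‖ < 1 := by simpa using ha'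
  obtain ⟨η, hη, h⟩ := (hφ.comp (isAut_mob (a := -(1 * a)) h1 hb)).eq_mul_of_zero
    (by simp [mob, ha0])
  refine ⟨η, a, hη, ha', fun z hz => ?_⟩
  have h2 := h _ (mob_mem_disc h1 ha' hz)
  have h3 := mob_mob h1 ha' hz
  rw [map_one] at h3
  rw [Function.comp_apply, h3] at h2
  rw [h2]; simp [mob]

/-! ### Area measure and change of variables. -/

lemma measurableSet_disc : MeasurableSet disc := isOpen_disc.measurableSet

lemma lintegral_areaMeasure (F : ℂ → ℝ≥0∞) :
    ∫⁻ z, F z ∂areaMeasure = ENNReal.ofReal Real.pi⁻¹ * ∫⁻ z in disc, F z := by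
  rw [areaMeasure, lintegral_smul_measure, smul_eq_mul]

lemma lintegral_areaMeasure_congr {F G : ℂ → ℝ≥0∞} (h : ∀ z ∈ disc, F z = G z) :
    ∫⁻ z, F z ∂areaMeasure = ∫⁻ z, G z ∂areaMeasure := by
  rw [lintegral_areaMeasure, lintegral_areaMeasure, setLIntegral_congr_fun measurableSet_disc h]

lemma lintegral_areaMeasure_mono {F G : ℂ → ℝ≥0∞} (h : ∀ z ∈ disc, F z ≤ G z) :
    ∫⁻ z, F z ∂areaMeasure ≤ ∫⁻ z, G z ∂areaMeasure := by
  rw [lintegral_areaMeasure, lintegral_areaMeasure]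
  exact mul_le_mul_right (setLIntegral_mono' measurableSet_disc h) _

/-- Change of variables for an injective analytic map of the disc onto itself. -/
lemma lintegral_comp_aut {ψ ψ' : ℂ → ℂ} (hψ : IsAut ψ)
    (hd : ∀ z ∈ disc, HasDerivAt ψ (ψ' z) z) (F : ℂ → ℝ≥0∞) :
    ∫⁻ w, F w ∂areaMeasure = ∫⁻ z, ‖ψ' z‖ₑ ^ 2 * F (ψ z) ∂areaMeasure := by
  have h := lintegral_image_eq_lintegral_abs_det_fderiv_mul volume measurableSet_disc
    (f' := fun z => ((ContinuousLinearMap.toSpanSingleton ℂ (ψ' z)).restrictScalars ℝ))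
    (fun z hz => ((hd z hz).hasFDerivAt.restrictScalars ℝ).hasFDerivWithinAt) hψ.2.injOn F
  rw [hψ.2.image_eq] at h
  rw [lintegral_areaMeasure, lintegral_areaMeasure, h]
  congr 1
  refine setLIntegral_congr_fun measurableSet_disc fun z _ => ?_
  -- The real Jacobian of multiplication by `c` is `|c|²`.
  have hdet : ((ContinuousLinearMap.toSpanSingleton ℂ (ψ' z)).restrictScalars ℝ).det
      = ‖ψ' z‖ ^ 2 := by
    simp [ContinuousLinearMap.det, LinearMap.det_restrictScalars, Algebra.norm_complex_eq,
      Complex.normSq_eq_norm_sq]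
  simp only [hdet, abs_of_nonneg (sq_nonneg ‖ψ' z‖)]
  rw [ENNReal.ofReal_pow (norm_nonneg _), ofReal_norm]

lemma measurable_indicator_of_continuousOn {F : ℂ → ℂ} (hF : ContinuousOn F disc) :
    Measurable (disc.indicator F) := by
  classical
  rw [← Set.piecewise_eq_indicator]
  exact hF.measurable_piecewise continuousOn_const measurableSet_disc

/-! ### Parseval and integrals against radial weights. -/

/-- **Parseval's identity** for an absolutely convergent power series on the unit circle. -/
lemma tsum_norm_sq_eq_integral {a : ℕ → ℂ} (ha : Summable fun n => ‖a n‖) :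
    HasSum (fun n => ‖a n‖ ^ 2)
      ((2 * Real.pi)⁻¹ * ∫ θ in -Real.pi..Real.pi, ‖∑' n, a n * exp (θ * I) ^ n‖ ^ 2) := by
  have hsum : ∀ θ : ℝ, Summable fun n => a n * exp (θ * I) ^ n := fun θ => by
    refine Summable.of_norm ?_
    simpa [Complex.norm_exp_ofReal_mul_I] using ha
  -- The identity is known for polynomials; dominated convergence passes from the partial sums to
  -- the series.
  have hpoly : ∀ N : ℕ, ∑ n ∈ Finset.range N, ‖a n‖ ^ 2 =
      (2 * Real.pi)⁻¹ * ∫ θ in -Real.pi..Real.pi,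
        ‖∑ n ∈ Finset.range N, a n * exp (θ * I) ^ n‖ ^ 2 := by
    intro N
    set p : Polynomial ℂ := ∑ n ∈ Finset.range N, Polynomial.monomial n (a n) with hp
    have hcoeff : ∀ n, p.coeff n = if n < N then a n else 0 := by
      intro n
      simp [hp, Polynomial.coeff_monomial]
    have h := p.sum_sq_norm_coeff_eq_circleAverage
    rw [Real.circleAverage_eq_integral_add (-Real.pi)] at h
    have h1 : ∑ i ∈ p.support, ‖p.coeff i‖ ^ 2 = ∑ n ∈ Finset.range N, ‖a n‖ ^ 2 := by
      have hsub : p.support ⊆ Finset.range N := by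
        intro n hn
        rw [Polynomial.mem_support_iff, hcoeff] at hn
        simp only [Finset.mem_range]
        by_contra h'
        simp [h'] at hn
      rw [Finset.sum_subset hsub fun n _ hn => by simp [Polynomial.notMem_support_iff.mp hn]]
      exact Finset.sum_congr rfl fun n hn => by rw [hcoeff, if_pos (Finset.mem_range.mp hn)]
    rw [h1] at h
    rw [h, smul_eq_mul, intervalIntegral.integral_comp_add_right
      (fun θ => ‖p.eval (circleMap 0 1 θ)‖ ^ 2)]
    congr 1
    rw [show (0 : ℝ) + -Real.pi = -Real.pi by ring,
      show 2 * Real.pi + -Real.pi = Real.pi by ring]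
    refine intervalIntegral.integral_congr fun θ _ => ?_
    simp [hp, Polynomial.eval_finsetSum, circleMap]
  have hs2 : Summable fun n => ‖a n‖ ^ 2 := by
    refine Summable.of_norm_bounded_eventually_nat ha ?_
    filter_upwards [ha.tendsto_atTop_zero.eventually_le_const zero_lt_one] with n hn
    rw [Real.norm_of_nonneg (by positivity)]
    nlinarith [norm_nonneg (a n)]
  refine (hs2.hasSum_iff_tendsto_nat).mpr ?_
  simp_rw [hpoly]
  refine Tendsto.const_mul _ ?_
  refine intervalIntegral.tendsto_integral_filter_of_dominated_convergence
    (fun _ => (∑' n, ‖a n‖) ^ 2) ?_ ?_ (by simp) ?_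
  · refine Eventually.of_forall fun N => Continuous.aestronglyMeasurable ?_
    fun_prop
  · refine Eventually.of_forall fun N => Eventually.of_forall fun θ _ => ?_
    rw [Real.norm_of_nonneg (by positivity)]
    gcongr
    refine (norm_sum_le _ _).trans ?_
    simp only [norm_mul, norm_pow, Complex.norm_exp_ofReal_mul_I, one_pow, mul_one]
    exact ha.sum_le_tsum _ fun _ _ => norm_nonneg _
  · refine Eventually.of_forall fun θ _ => ?_
    exact ((hsum θ).hasSum.tendsto_sum_nat.norm).pow 2

lemma lintegral_circle_tsum {a : ℕ → ℂ} (ha : Summable fun n => ‖a n‖) :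
    ∫⁻ θ in Ioo (-Real.pi) Real.pi, ‖∑' n, a n * exp ((θ : ℝ) * I) ^ n‖ₑ ^ 2 =
      ENNReal.ofReal (2 * Real.pi) * ∑' n, ‖a n‖ₑ ^ 2 := by
  have h := tsum_norm_sq_eq_integral ha
  have hcont : Continuous fun θ : ℝ => ∑' n, a n * exp (θ * I) ^ n := by
    refine continuous_tsum (fun n => by fun_prop) ha fun n θ => ?_
    simp [Complex.norm_exp_ofReal_mul_I]
  have h1 : ∑' n, ‖a n‖ₑ ^ 2 = ENNReal.ofReal (∑' n, ‖a n‖ ^ 2) := by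
    rw [ENNReal.ofReal_tsum_of_nonneg (fun _ => by positivity) h.summable]
    congr 1 with n
    rw [ENNReal.ofReal_pow (norm_nonneg _), ofReal_norm]
  have h2 : ∫⁻ θ in Ioo (-Real.pi) Real.pi, ‖∑' n, a n * exp ((θ : ℝ) * I) ^ n‖ₑ ^ 2 =
      ENNReal.ofReal (∫ θ in -Real.pi..Real.pi, ‖∑' n, a n * exp (θ * I) ^ n‖ ^ 2) := by
    rw [intervalIntegral.integral_of_le (by linarith [Real.pi_pos]), integral_Ioc_eq_integral_Ioo,
      ofReal_integral_eq_lintegral_ofReal]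
    · refine lintegral_congr fun θ => ?_
      rw [ENNReal.ofReal_pow (norm_nonneg _), ofReal_norm]
    · exact ((hcont.norm.pow 2).integrableOn_Icc (a := -Real.pi) (b := Real.pi)).mono_set
        Ioo_subset_Icc_self
    · exact Eventually.of_forall fun θ => by positivity
  rw [h1, h2, h.tsum_eq, ← ENNReal.ofReal_mul (by positivity), ← mul_assoc,
    mul_inv_cancel₀ (by positivity), one_mul]

/-- The mean square on the circle of radius `r` of a power series converging in the disc. -/
lemma lintegral_circle_sq {F : ℂ → ℂ} {a : ℕ → ℂ}
    (ha : ∀ z ∈ disc, HasSum (fun n => a n * z ^ n) (F z)) {r : ℝ} (hr0 : 0 ≤ r) (hr1 : r < 1) :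
    ∫⁻ θ in Ioo (-Real.pi) Real.pi, ‖F (r * exp ((θ : ℝ) * I))‖ₑ ^ 2 =
      ENNReal.ofReal (2 * Real.pi) * ∑' n, ‖a n‖ₑ ^ 2 * ENNReal.ofReal r ^ (2 * n) := by
  have hmem : ∀ θ : ℝ, (r * exp (θ * I) : ℂ) ∈ disc := fun θ => by
    rw [mem_disc, norm_mul, Complex.norm_exp_ofReal_mul_I, mul_one, Complex.norm_real,
      Real.norm_of_nonneg hr0]
    exact hr1
  have hs : Summable fun n => ‖a n * (r : ℂ) ^ n‖ :=
    (ha r (by simpa using hmem 0)).summable.norm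
  have h := lintegral_circle_tsum hs
  simp only [enorm_mul, enorm_pow, mul_pow, ← pow_mul] at h
  have hr : ‖(r : ℂ)‖ₑ = ENNReal.ofReal r := by
    rw [← ofReal_norm, Complex.norm_real, Real.norm_of_nonneg hr0]
  simp only [hr, mul_comm _ 2] at h
  rw [← h]
  refine lintegral_congr fun θ => ?_
  rw [← (ha _ (hmem θ)).tsum_eq]
  simp only [mul_pow, mul_assoc]

/-- The area integral of the squared modulus of a power series against a radial weight. -/
lemma lintegral_sq_mul_radial {F : ℂ → ℂ} {a : ℕ → ℂ} (hF : ContinuousOn F disc)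
    (ha : ∀ z ∈ disc, HasSum (fun n => a n * z ^ n) (F z)) {V : ℝ → ℝ≥0∞} (hV : Measurable V) :
    ∫⁻ z, ‖F z‖ₑ ^ 2 * V ‖z‖ ∂areaMeasure =
      2 * ∫⁻ r in Ioo (0 : ℝ) 1, ENNReal.ofReal r * V r *
        ∑' n, ‖a n‖ₑ ^ 2 * ENNReal.ofReal r ^ (2 * n) := by
  have hE := measurable_indicator_of_continuousOn hF
  -- `F` is controlled only on the disc; its extension by zero is measurable on the plane, so polar
  -- coordinates and Tonelli apply.
  set E := disc.indicator F with hEdef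
  have hEm : Measurable fun z : ℂ => ‖E z‖ₑ ^ 2 * V ‖z‖ := by fun_prop
  have h1 : ∫⁻ z in disc, ‖F z‖ₑ ^ 2 * V ‖z‖ = ∫⁻ z, ‖E z‖ₑ ^ 2 * V ‖z‖ := by
    rw [← lintegral_indicator measurableSet_disc]
    refine lintegral_congr fun z => ?_
    by_cases hz : z ∈ disc <;> simp [hEdef, hz]
  have hpol : ∀ r θ : ℝ, Complex.polarCoord.symm (r, θ) = r * exp (θ * I) := fun r θ => by
    rw [Complex.polarCoord_symm_apply, Complex.exp_mul_I, Complex.ofReal_cos, Complex.ofReal_sin]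
  rw [lintegral_areaMeasure, h1, ← Complex.lintegral_comp_polarCoord_symm, polarCoord_target,
    Measure.volume_eq_prod, ← Measure.prod_restrict, lintegral_prod]
  · simp only [hpol, smul_eq_mul]
    rw [← lintegral_indicator measurableSet_Ioi, ← lintegral_indicator measurableSet_Ioo,
      ← lintegral_const_mul' _ _ ENNReal.ofReal_ne_top, ← lintegral_const_mul' _ _ (by simp)]
    refine lintegral_congr fun r => ?_
    by_cases hr0 : 0 < r
    swap
    · simp [hr0]
    have hnorm : ∀ θ : ℝ, ‖(r * exp (θ * I) : ℂ)‖ = r := fun θ => by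
      rw [norm_mul, Complex.norm_exp_ofReal_mul_I, mul_one, Complex.norm_real,
        Real.norm_of_nonneg hr0.le]
    by_cases hr1 : r < 1
    · have hEF : ∀ θ : ℝ, E (r * exp (θ * I)) = F (r * exp (θ * I)) := fun θ => by
        rw [hEdef, Set.indicator_of_mem (by rw [mem_disc, hnorm]; exact hr1)]
      rw [Set.indicator_of_mem (by exact hr0), Set.indicator_of_mem (by exact ⟨hr0, hr1⟩)]
      simp only [hnorm, hEF]
      have : ∀ θ : ℝ, ENNReal.ofReal r * (‖F (r * exp (θ * I))‖ₑ ^ 2 * V r) =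
          (ENNReal.ofReal r * V r) * ‖F (r * exp (θ * I))‖ₑ ^ 2 := fun θ => by ring
      simp only [this]
      rw [lintegral_const_mul'', lintegral_circle_sq ha hr0.le hr1]
      · rw [ENNReal.ofReal_mul zero_le_two, ENNReal.ofReal_ofNat]
        have hpi : ENNReal.ofReal Real.pi⁻¹ * ENNReal.ofReal Real.pi = 1 := by
          rw [← ENNReal.ofReal_mul (by positivity), inv_mul_cancel₀ Real.pi_ne_zero,
            ENNReal.ofReal_one]
        calc _ = (ENNReal.ofReal Real.pi⁻¹ * ENNReal.ofReal Real.pi) * (2 *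
              (ENNReal.ofReal r * V r * ∑' n, ‖a n‖ₑ ^ 2 * ENNReal.ofReal r ^ (2 * n))) := by ring
          _ = _ := by rw [hpi, one_mul]
      · simp only [← hEF]
        exact (Measurable.pow_const (by fun_prop) 2).aemeasurable
    · rw [Set.indicator_of_mem (by exact hr0), Set.indicator_of_notMem (by simp [hr1])]
      have : ∀ θ : ℝ, E (r * exp (θ * I)) = 0 := fun θ => by
        rw [hEdef, Set.indicator_of_notMem (by rw [mem_disc, hnorm]; exact hr1)]
      simp [this]
  · refine Measurable.aemeasurable ?_
    simp only [smul_eq_mul]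
    refine Measurable.mul (by fun_prop) (hEm.comp ?_)
    have : (Complex.polarCoord.symm : ℝ × ℝ → ℂ) = fun p => (p.1 : ℂ) * exp (p.2 * I) := by
      ext p; exact hpol p.1 p.2
    rw [this]
    fun_prop

/-! ### The Littlewood–Paley identity. -/

/-- The radial weight `log (1 / r²)`, equal to `+∞` at `r = 0`. -/
noncomputable def logWeight (r : ℝ) : ℝ≥0∞ :=
  if r = 0 then ⊤ else ENNReal.ofReal (Real.log (r⁻¹ ^ 2))

lemma measurable_logWeight : Measurable logWeight :=
  Measurable.ite (measurableSet_singleton 0) measurable_const (by fun_prop)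

lemma greenKernel_eq_logWeight {z w : ℂ} (hz : ‖z‖ ≤ 1) (hw : ‖w‖ < 1) :
    greenKernel z w = logWeight ‖mob 1 w z‖ := by
  have h := one_sub_conj_mul_ne_zero hw hz
  rw [greenKernel, logWeight, norm_mob norm_one]
  by_cases hzw : z = w
  · simp [hzw]
  · have h1 : ‖z - w‖ / ‖1 - conj w * z‖ ≠ 0 := by
      simp [sub_ne_zero.mpr hzw, h]
    rw [if_neg hzw, if_neg h1, inv_div, norm_div]

/-- This moment cancels exactly the factor `(n + 1) ^ 2` that differentiation puts on the squared
Taylor coefficients. -/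
lemma lintegral_logWeight_mul_pow (n : ℕ) :
    2 * ∫⁻ r in Ioo (0 : ℝ) 1, ENNReal.ofReal r * logWeight r * ENNReal.ofReal r ^ (2 * n) =
      ENNReal.ofReal (((n + 1 : ℝ) ^ 2)⁻¹) := by
  -- Keeping `r * Real.log r` together makes the integrand and its primitive `G`, found by parts,
  -- continuous at `0`.
  set f : ℝ → ℝ := fun r => -4 * (r ^ (2 * n) * (r * Real.log r)) with hf
  set G : ℝ → ℝ := fun r => -4 * (r ^ (2 * n + 1) * (r * Real.log r) / (2 * n + 2)
    - r ^ (2 * n + 2) / (2 * n + 2) ^ 2) with hG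
  have hfc : Continuous f := by
    have := Real.continuous_mul_log
    fun_prop
  have hGc : Continuous G := by
    have := Real.continuous_mul_log
    fun_prop
  have hint : ∫ r in (0 : ℝ)..1, f r = ((n + 1 : ℝ) ^ 2)⁻¹ := by
    rw [intervalIntegral.integral_eq_sub_of_hasDerivAt_of_le zero_le_one hGc.continuousOn
      (f' := f) ?_ (hfc.intervalIntegrable 0 1)]
    · simp only [hG]
      simp
      field_simp
      ring
    · intro r hr
      have h1 := (hasDerivAt_pow (2 * n + 1) r).mul ((hasDerivAt_id r).mul
        (Real.hasDerivAt_log hr.1.ne'))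
      have h2 := hasDerivAt_pow (2 * n + 2) r
      have h3 := ((h1.div_const (2 * n + 2 : ℝ)).sub (h2.div_const ((2 * n + 2 : ℝ) ^ 2))).const_mul
        (-4)
      convert! h3 using 1
      have := hr.1.ne'
      simp only [hf, Pi.mul_apply, id]
      push_cast
      field_simp
      ring
  rw [← hint, intervalIntegral.integral_of_le zero_le_one, integral_Ioc_eq_integral_Ioo,
    ofReal_integral_eq_lintegral_ofReal, ← lintegral_const_mul' _ _ (by simp)]
  · refine setLIntegral_congr_fun measurableSet_Ioo fun r hr => ?_
    have hl : logWeight r = ENNReal.ofReal (-2 * Real.log r) := by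
      rw [logWeight, if_neg hr.1.ne', Real.log_pow, Real.log_inv]
      congr 1; push_cast; ring
    have hlog := Real.log_neg hr.1 hr.2
    have h0 := hr.1.le
    simp only [hl, hf]
    rw [← ENNReal.ofReal_pow h0, ← ENNReal.ofReal_mul h0, ← ENNReal.ofReal_mul (by nlinarith),
      show (2 : ℝ≥0∞) = ENNReal.ofReal 2 by simp, ← ENNReal.ofReal_mul (by simp)]
    congr 1; ring
  · exact (hfc.integrableOn_Icc (a := 0) (b := 1)).mono_set Ioo_subset_Icc_self
  · filter_upwards [self_mem_ae_restrict measurableSet_Ioo] with r hr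
    have hlog := Real.log_neg hr.1 hr.2
    have h1 := mul_nonneg (pow_nonneg hr.1.le (2 * n))
      (mul_nonneg hr.1.le (neg_nonneg.mpr hlog.le))
    simp only [hf, Pi.zero_apply]
    linarith

lemma hasSum_taylorCoeff {f : ℂ → ℂ} (hf : Hol f) {z : ℂ} (hz : z ∈ disc) :
    HasSum (fun n => taylorCoeff f n * z ^ n) (f z) := by
  convert! Complex.hasSum_taylorSeries_on_ball (c := 0) (r := 1) hf hz using 2 with n
  simp [taylorCoeff]; ring

lemma taylorCoeff_zero (f : ℂ → ℂ) : taylorCoeff f 0 = f 0 := by simp [taylorCoeff]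

lemma taylorCoeff_deriv (f : ℂ → ℂ) (n : ℕ) :
    taylorCoeff (deriv f) n = (n + 1) * taylorCoeff f (n + 1) := by
  rw [taylorCoeff, taylorCoeff, iteratedDeriv_succ', Nat.factorial_succ]
  have : (n + 1 : ℂ) ≠ 0 := Nat.cast_add_one_ne_zero n
  push_cast
  field_simp

lemma Hol.deriv {f : ℂ → ℂ} (hf : Hol f) : Hol (deriv f) :=
  DifferentiableOn.deriv hf isOpen_disc

lemma Hol.hasDerivAt {f : ℂ → ℂ} (hf : Hol f) {z : ℂ} (hz : z ∈ disc) :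
    HasDerivAt f (_root_.deriv f z) z :=
  (hf.differentiableAt (isOpen_disc.mem_nhds hz)).hasDerivAt

/-- The **Littlewood–Paley identity**. -/
lemma lintegral_deriv_sq_logWeight {G : ℂ → ℂ} (hG : Hol G) :
    ∫⁻ z, ‖deriv G z‖ₑ ^ 2 * logWeight ‖z‖ ∂areaMeasure = ∑' n, ‖taylorCoeff G (n + 1)‖ₑ ^ 2 := by
  rw [lintegral_sq_mul_radial hG.deriv.continuousOn (fun z hz => hasSum_taylorCoeff hG.deriv hz)
    measurable_logWeight]
  have hm := measurable_logWeight
  simp_rw [← ENNReal.tsum_mul_left]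
  rw [lintegral_tsum (fun n => Measurable.aemeasurable (by fun_prop)), ← ENNReal.tsum_mul_left]
  congr 1 with n
  have h1 : ∀ r : ℝ, ENNReal.ofReal r * logWeight r *
      (‖taylorCoeff (deriv G) n‖ₑ ^ 2 * ENNReal.ofReal r ^ (2 * n)) =
      ‖taylorCoeff (deriv G) n‖ₑ ^ 2 *
        (ENNReal.ofReal r * logWeight r * ENNReal.ofReal r ^ (2 * n)) := fun r => by ring
  simp_rw [h1]
  rw [lintegral_const_mul _ (by fun_prop), mul_left_comm, lintegral_logWeight_mul_pow,
    taylorCoeff_deriv, enorm_mul, mul_pow, mul_right_comm]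
  have h2 : ‖(n + 1 : ℂ)‖ₑ ^ 2 = ENNReal.ofReal ((n + 1 : ℝ) ^ 2) := by
    rw [ENNReal.ofReal_pow (by positivity), ← ofReal_norm]
    congr 2
    exact_mod_cast Complex.norm_natCast (n + 1)
  rw [h2, ← ENNReal.ofReal_mul (by positivity), mul_inv_cancel₀ (by positivity),
    ENNReal.ofReal_one, one_mul]

/-! ### Multiplication by Möbius maps in `H²` and in Dirichlet integrals. -/

lemma norm_mob_sq_ge {η a z : ℂ} (hη : ‖η‖ = 1) (ha : ‖a‖ < 1) (hz : ‖z‖ ≤ 1) :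
    1 - (1 - ‖z‖ ^ 2) / (1 - ‖a‖) ^ 2 ≤ ‖mob η a z‖ ^ 2 := by
  have h := one_sub_norm_mob_sq hη ha hz
  have h1 : 1 - ‖a‖ ≤ ‖1 - conj a * z‖ := by
    have h2 := norm_sub_norm_le (1 : ℂ) (conj a * z)
    rw [norm_mul, norm_one, RCLike.norm_conj] at h2
    nlinarith [norm_nonneg a]
  have h3 : 0 < 1 - ‖a‖ := by linarith
  have h4 : 0 ≤ 1 - ‖z‖ ^ 2 := by nlinarith [norm_nonneg z]
  have h5 : (1 - ‖a‖ ^ 2) * (1 - ‖z‖ ^ 2) / ‖1 - conj a * z‖ ^ 2 ≤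
      (1 - ‖z‖ ^ 2) / (1 - ‖a‖) ^ 2 := by
    gcongr
    nlinarith [sq_nonneg ‖a‖]
  linarith

/-- Multiplication by a Möbius map does not decrease the norm of the Hardy space `H²`. -/
lemma tsum_taylorCoeff_sq_le_mob_mul {G : ℂ → ℂ} (hG : Hol G) {η a : ℂ} (hη : ‖η‖ = 1)
    (ha : ‖a‖ < 1) :
    ∑' n, ‖taylorCoeff G n‖ₑ ^ 2 ≤ ∑' n, ‖taylorCoeff (fun z => mob η a z * G z) n‖ₑ ^ 2 := by
  have hH : Hol (fun z => mob η a z * G z) := (hol_mob ha).mul hG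
  set H := fun z => mob η a z * G z with hHdef
  -- A lower bound for `|mob η a z|²` that is uniform on the circle `|z| = r` and tends to `1` as `r
  -- → 1`.
  set m : ℝ → ℝ := fun r => 1 - (1 - r ^ 2) / (1 - ‖a‖) ^ 2 with hm
  have hpi : ENNReal.ofReal (2 * Real.pi) ≠ 0 := by simp [Real.pi_pos]
  have hcirc : ∀ r : ℝ, 0 ≤ r → r < 1 →
      ENNReal.ofReal (m r) * ∑' n, ‖taylorCoeff G n‖ₑ ^ 2 * ENNReal.ofReal r ^ (2 * n) ≤
        ∑' n, ‖taylorCoeff H n‖ₑ ^ 2 := by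
    intro r hr0 hr1
    have hGc := lintegral_circle_sq (fun z hz => hasSum_taylorCoeff hG hz) hr0 hr1
    have hHc := lintegral_circle_sq (fun z hz => hasSum_taylorCoeff hH hz) hr0 hr1
    have h1 : ENNReal.ofReal (2 * Real.pi) * (ENNReal.ofReal (m r) *
        ∑' n, ‖taylorCoeff G n‖ₑ ^ 2 * ENNReal.ofReal r ^ (2 * n)) ≤
        ENNReal.ofReal (2 * Real.pi) *
          ∑' n, ‖taylorCoeff H n‖ₑ ^ 2 * ENNReal.ofReal r ^ (2 * n) := by
      rw [mul_left_comm, ← hGc, ← hHc, ← lintegral_const_mul' _ _ ENNReal.ofReal_ne_top]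
      refine lintegral_mono fun θ => ?_
      rw [hHdef]
      simp only [enorm_mul (mob _ _ _), mul_pow]
      gcongr
      rw [← ofReal_norm, ← ENNReal.ofReal_pow (norm_nonneg _)]
      refine ENNReal.ofReal_le_ofReal ?_
      have hz : ‖(r * exp (θ * I) : ℂ)‖ = r := by
        rw [norm_mul, Complex.norm_exp_ofReal_mul_I, mul_one, Complex.norm_real,
          Real.norm_of_nonneg hr0]
      have := norm_mob_sq_ge (z := r * exp (θ * I)) hη ha (by rw [hz]; exact hr1.le)
      rwa [hz] at this
    refine ((ENNReal.mul_le_mul_iff_right hpi ENNReal.ofReal_ne_top).mp h1).trans ?_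
    refine ENNReal.tsum_le_tsum fun n => mul_le_of_le_one_right' (pow_le_one₀ (by simp) ?_)
    simpa using hr1.le
  -- On finite partial sums the limit `r → 1` is plain continuity; the supremum is taken afterwards.
  rw [ENNReal.tsum_eq_iSup_sum]
  refine iSup_le fun s => ?_
  have hlim : Tendsto (fun r : ℝ => ENNReal.ofReal (m r) *
      ∑ n ∈ s, ‖taylorCoeff G n‖ₑ ^ 2 * ENNReal.ofReal r ^ (2 * n)) (𝓝[<] 1)
      (𝓝 (1 * ∑ n ∈ s, ‖taylorCoeff G n‖ₑ ^ 2)) := by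
    refine Tendsto.mono_left ?_ nhdsWithin_le_nhds
    refine ENNReal.Tendsto.mul ?_ (by simp) (tendsto_finsetSum _ fun n _ => ?_) (by simp)
    · have : Tendsto m (𝓝 1) (𝓝 1) := by
        have h : ContinuousAt m 1 := by fun_prop
        have h2 : m 1 = 1 := by simp [hm]
        rw [ContinuousAt, h2] at h
        exact h
      simpa using ENNReal.tendsto_ofReal this
    · have h1 : Tendsto (fun r : ℝ => ENNReal.ofReal r ^ (2 * n)) (𝓝 1) (𝓝 1) := by
        simpa [Function.comp_def] using
          ((ENNReal.continuous_pow (2 * n)).comp ENNReal.continuous_ofReal).tendsto 1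
      simpa using ENNReal.Tendsto.const_mul (a := ‖taylorCoeff G n‖ₑ ^ 2) h1 (by simp)
  rw [one_mul] at hlim
  refine le_of_tendsto hlim ?_
  filter_upwards [Ioo_mem_nhdsLT (zero_lt_one (α := ℝ))] with r hr
  exact (mul_le_mul_right (ENNReal.sum_le_tsum s) _).trans (hcirc r hr.1.le hr.2)

/-- The `H²` inequality survives removing the constant terms, because `|mob η a 0| ≤ 1` and `‖G 0‖ₑ`
is finite and can be cancelled. -/
lemma tsum_taylorCoeff_succ_sq_le_mob_mul {G : ℂ → ℂ} (hG : Hol G) {η a : ℂ} (hη : ‖η‖ = 1)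
    (ha : ‖a‖ < 1) :
    ∑' n, ‖taylorCoeff G (n + 1)‖ₑ ^ 2 ≤
      ∑' n, ‖taylorCoeff (fun z => mob η a z * G z) (n + 1)‖ₑ ^ 2 := by
  have h := tsum_taylorCoeff_sq_le_mob_mul hG hη ha
  rw [tsum_eq_zero_add' (f := fun n => ‖taylorCoeff G n‖ₑ ^ 2) ENNReal.summable,
    tsum_eq_zero_add' (f := fun n => ‖taylorCoeff (fun z => mob η a z * G z) n‖ₑ ^ 2)
      ENNReal.summable, taylorCoeff_zero,
    taylorCoeff_zero, enorm_mul] at h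
  have h1 : (‖mob η a 0‖ₑ * ‖G 0‖ₑ) ^ 2 ≤ ‖G 0‖ₑ ^ 2 := by
    gcongr
    refine mul_le_of_le_one_left' ?_
    rw [← ofReal_norm, ENNReal.ofReal_le_one]
    exact (mem_disc.mp (mob_mem_disc hη ha zero_mem_disc)).le
  exact (ENNReal.add_le_add_iff_left (by simp)).mp (h.trans (add_le_add_left h1 _))

/-- Substituting the inverse Möbius map makes the weight `logWeight ‖z‖`, and Littlewood–Paley
applies to the composition. -/
lemma lintegral_deriv_sq_mul_logWeight_aut {g : ℂ → ℂ} (hg : Hol g) {η a : ℂ} (hη : ‖η‖ = 1)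
    (ha : ‖a‖ < 1) :
    ∫⁻ w, ‖deriv g w‖ₑ ^ 2 * logWeight ‖mob η a w‖ ∂areaMeasure =
      ∑' n, ‖taylorCoeff (fun z => g (mob (conj η) (-(η * a)) z)) (n + 1)‖ₑ ^ 2 := by
  have hη' : ‖conj η‖ = 1 := by simpa using hη
  have ha' : ‖-(η * a)‖ < 1 := by simpa [hη] using ha
  have haut := isAut_mob hη' ha'
  have hcomp : Hol (fun z => g (mob (conj η) (-(η * a)) z)) := hg.comp haut.1 haut.2.mapsTo
  rw [← lintegral_deriv_sq_logWeight hcomp,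
    lintegral_comp_aut haut (fun z hz => haut.1.hasDerivAt hz)]
  refine lintegral_areaMeasure_congr fun z hz => ?_
  have hd := (hg.hasDerivAt (haut.2.mapsTo hz)).comp z (haut.1.hasDerivAt hz)
  rw [mob_mob' hη ha hz, ← mul_assoc, show deriv (fun z => g (mob (conj η) (-(η * a)) z)) z = _
    from hd.deriv, enorm_mul]
  ring

/-- Multiplication by `z` does not decrease the Dirichlet integral against a Green potential. -/
lemma lintegral_deriv_sq_mul_greenKernel_le {g h : ℂ → ℂ} (hg : Hol g)
    (hgh : ∀ z ∈ disc, h z = z * g z) {φ : ℂ → ℂ} (hφ : IsAut φ) {w : ℂ} (hw : w ∈ disc) :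
    ∫⁻ z, ‖deriv g z‖ₑ ^ 2 * greenKernel (φ z) w ∂areaMeasure ≤
      ∫⁻ z, ‖deriv h z‖ₑ ^ 2 * greenKernel (φ z) w ∂areaMeasure := by
  have hh : Hol h := DifferentiableOn.congr (f := fun z => z * g z)
    (DifferentiableOn.mul differentiableOn_id hg) hgh
  rw [mem_disc] at hw
  -- The Green kernel with pole `w`, moved by `φ`, is the logarithmic weight of the automorphism
  -- `mob 1 w ∘ φ`. In the coordinate of this automorphism the multiplier `z` becomes a Möbius map.
  obtain ⟨η, a, hη, ha, hτ⟩ := ((isAut_mob norm_one hw).comp hφ).exists_eq_mob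
  have hk : ∀ z ∈ disc, greenKernel (φ z) w = logWeight ‖mob η a z‖ := fun z hz => by
    rw [← hτ z hz, greenKernel_eq_logWeight (mem_disc.mp (hφ.2.mapsTo hz)).le hw]; rfl
  have hη' : ‖conj η‖ = 1 := by simpa using hη
  have ha' : ‖-(η * a)‖ < 1 := by simpa [hη] using ha
  have haut := isAut_mob hη' ha'
  rw [lintegral_areaMeasure_congr fun z hz => by rw [hk z hz],
    lintegral_areaMeasure_congr (F := fun z => ‖deriv h z‖ₑ ^ 2 * _) fun z hz => by rw [hk z hz],
    lintegral_deriv_sq_mul_logWeight_aut hg hη ha, lintegral_deriv_sq_mul_logWeight_aut hh hη ha]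
  have hcomp : Hol (fun z => g (mob (conj η) (-(η * a)) z)) := hg.comp haut.1 haut.2.mapsTo
  refine (tsum_taylorCoeff_succ_sq_le_mob_mul hcomp hη' ha').trans_eq ?_
  congr 1 with n
  have : (fun z => mob (conj η) (-(η * a)) z * g (mob (conj η) (-(η * a)) z)) =ᶠ[𝓝 0]
      fun z => h (mob (conj η) (-(η * a)) z) := by
    filter_upwards [isOpen_disc.mem_nhds zero_mem_disc] with z hz
    rw [hgh _ (haut.2.mapsTo hz)]
  rw [taylorCoeff, taylorCoeff, this.iteratedDeriv_eq]

/-! ### Green potentials: radiality, σ-finiteness, Tonelli. -/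

lemma measurable_greenKernel : Measurable fun p : ℂ × ℂ => greenKernel p.1 p.2 := by
  unfold greenKernel
  refine Measurable.ite (measurableSet_eq_fun measurable_fst measurable_snd) measurable_const ?_
  have : Measurable (starRingEnd ℂ) := Complex.continuous_conj.measurable
  fun_prop

lemma greenKernel_rotate {lam : ℂ} (h : ‖lam‖ = 1) (z w : ℂ) :
    greenKernel (lam * z) (lam * w) = greenKernel z w := by
  have h0 : lam ≠ 0 := by rintro rfl; simp at h
  have h1 := mul_conj_of_norm_eq_one h
  have h2 : 1 - conj (lam * w) * (lam * z) = 1 - conj w * z := by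
    rw [map_mul]; linear_combination (-conj w * z) * h1
  rw [greenKernel, greenKernel, h2, ← mul_sub, norm_div, norm_div, norm_mul lam, h, one_mul]
  simp [h0]

lemma potential_rotate {μ : Measure ℂ} (hμ : IsRadial μ) {lam : ℂ} (h : ‖lam‖ = 1) (z : ℂ) :
    potential μ (lam * z) = potential μ z := by
  have hm : Measurable fun w => greenKernel (lam * z) w :=
    measurable_greenKernel.comp measurable_prodMk_left
  have hpre : (fun w => lam * w) ⁻¹' disc = disc := by
    ext w; simp [mem_disc, h]
  calc potential μ (lam * z) = ∫⁻ w in disc, greenKernel (lam * z) w ∂(μ.map fun w => lam * w) := by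
        rw [hμ lam h]; rfl
    _ = potential μ z := by
        rw [setLIntegral_map measurableSet_disc hm (by fun_prop), hpre]
        simp only [greenKernel_rotate h]; rfl

lemma potential_eq_norm {μ : Measure ℂ} (hμ : IsRadial μ) (z : ℂ) :
    potential μ z = potential μ (‖z‖ : ℂ) := by
  conv_lhs => rw [← Complex.norm_mul_exp_arg_mul_I z, mul_comm]
  exact potential_rotate hμ (Complex.norm_exp_ofReal_mul_I _) _

lemma greenKernel_ne_zero {z w : ℂ} (hz : z ∈ disc) (hw : w ∈ disc) : greenKernel z w ≠ 0 := by
  rw [mem_disc] at hz hw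
  rw [greenKernel]
  split_ifs with h
  · simp
  · have h1 := norm_sq_one_sub_conj_mul_sub w z
    have h2 : 0 < ‖z - w‖ := by simpa [sub_eq_zero] using h
    have h3 : 0 < (1 - ‖w‖ ^ 2) * (1 - ‖z‖ ^ 2) :=
      mul_pos (by nlinarith [norm_nonneg w]) (by nlinarith [norm_nonneg z])
    rw [Ne, ENNReal.ofReal_eq_zero, not_le]
    refine Real.log_pos ?_
    rw [norm_div, div_pow, one_lt_div (by positivity)]
    linarith

/-- If the potential is finite at one point of the disc, the measure is σ-finite on the disc. -/
lemma sigmaFinite_of_potential_lt_top {μ : Measure ℂ} {z : ℂ} (hz : z ∈ disc)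
    (h : potential μ z < ⊤) : SigmaFinite (μ.restrict disc) := by
  have hm : Measurable fun w => greenKernel z w :=
    measurable_greenKernel.comp measurable_prodMk_left
  -- Markov's inequality makes the superlevel sets of the kernel finite in measure; they exhaust the
  -- disc because the kernel is positive there.
  refine ⟨⟨⟨fun n => {w | ((n : ℝ≥0∞) + 1)⁻¹ ≤ greenKernel z w} ∪ discᶜ, fun _ => trivial,
    fun n => ?_, ?_⟩⟩⟩
  · refine (measure_union_le _ _).trans_lt (ENNReal.add_lt_top.mpr ⟨?_, ?_⟩)
    · exact (meas_ge_le_lintegral_div hm.aemeasurable (by simp) (by simp)).trans_lt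
        (ENNReal.div_lt_top h.ne (by simp))
    · rw [Measure.restrict_apply measurableSet_disc.compl]; simp
  · refine eq_univ_of_forall fun w => mem_iUnion.mpr ?_
    by_cases hw : w ∈ disc
    · obtain ⟨n, hn⟩ := ENNReal.exists_inv_nat_lt (greenKernel_ne_zero hz hw)
      refine ⟨n, Or.inl (le_trans (ENNReal.inv_le_inv.mpr ?_) hn.le)⟩
      exact le_self_add
    · exact ⟨0, Or.inr hw⟩

lemma measurable_potential {μ : Measure ℂ} [SFinite (μ.restrict disc)] :
    Measurable (potential μ) :=
  measurable_greenKernel.lintegral_prod_right'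

instance : SFinite areaMeasure := by unfold areaMeasure; infer_instance

lemma measurable_mob (η a : ℂ) : Measurable (mob η a) := by unfold mob; fun_prop

/-- Multiplication by `z` does not decrease the Dirichlet integrals defining `M(𝒟_μ)`. -/
lemma lintegral_deriv_sq_mul_potential_le {μ : Measure ℂ} [SFinite (μ.restrict disc)] {g h : ℂ → ℂ}
    (hg : Hol g) (hgh : ∀ z ∈ disc, h z = z * g z) {φ : ℂ → ℂ} (hφ : IsAut φ) :
    ∫⁻ z, ‖deriv g z‖ₑ ^ 2 * potential μ (φ z) ∂areaMeasure ≤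
      ∫⁻ z, ‖deriv h z‖ₑ ^ 2 * potential μ (φ z) ∂areaMeasure := by
  obtain ⟨η, a, hη, ha, hφm⟩ := hφ.exists_eq_mob
  have key : ∀ u : ℂ → ℂ, ∫⁻ z, ‖deriv u z‖ₑ ^ 2 * potential μ (φ z) ∂areaMeasure =
      ∫⁻ w in disc, ∫⁻ z, ‖deriv u z‖ₑ ^ 2 * greenKernel (mob η a z) w ∂areaMeasure ∂μ := by
    intro u
    have hm1 := measurable_mob η a
    have hm2 := measurable_deriv u
    rw [lintegral_areaMeasure_congr fun z hz => by rw [hφm z hz], ← lintegral_lintegral_swap]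
    · refine lintegral_congr fun z => ?_
      have : Measurable fun w => greenKernel (mob η a z) w :=
        measurable_greenKernel.comp measurable_prodMk_left
      rw [lintegral_const_mul _ this]
      rfl
    · refine Measurable.aemeasurable ?_
      have : Measurable fun p : ℂ × ℂ => greenKernel (mob η a p.1) p.2 :=
        measurable_greenKernel.comp (f := fun p : ℂ × ℂ => (mob η a p.1, p.2)) (by fun_prop)
      simp only [Function.uncurry_def]
      fun_prop
  rw [key, key]
  refine setLIntegral_mono' measurableSet_disc fun w hw => ?_
  exact lintegral_deriv_sq_mul_greenKernel_le hg hgh (isAut_mob hη ha) hw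

/-! ### The extremal problem for two poles. -/

lemma hasSum_norm_sq_pow_sub_pow {k d : ℂ} (hk : ‖k‖ = 1) (hd : ‖d‖ ≤ 1) {x : ℝ} (hx0 : 0 ≤ x)
    (hx1 : x < 1) :
    HasSum (fun n => ‖k ^ (n + 1) - d ^ (n + 1)‖ ^ 2 * x ^ n)
      ((1 - x)⁻¹ + ‖d‖ ^ 2 * (1 - ‖d‖ ^ 2 * x)⁻¹ -
        2 * (k * conj d * (1 - k * conj d * x)⁻¹).re) := by
  have hd2 : ‖d‖ ^ 2 ≤ 1 := pow_le_one₀ (norm_nonneg _) hd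
  -- Expanding the square gives three geometric series, with ratios `x`, `‖d‖² x` and `k d̄ x`.
  have h1 := hasSum_geometric_of_lt_one hx0 hx1
  have h2 := (hasSum_geometric_of_lt_one (r := ‖d‖ ^ 2 * x) (by positivity)
    (by nlinarith)).mul_left (‖d‖ ^ 2)
  have h3 := ((Complex.hasSum_re ((hasSum_geometric_of_norm_lt_one (ξ := k * conj d * x)
    (by simp [hk, abs_of_nonneg hx0]; nlinarith [norm_nonneg d])).mul_left
      (k * conj d)))).mul_left 2
  convert! (h1.add h2).sub h3 using 2 with n
  have h4 : (k * conj d * (k * conj d * (x : ℂ)) ^ n).re =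
      (k ^ (n + 1) * conj (d ^ (n + 1))).re * x ^ n := by
    rw [← Complex.re_mul_ofReal]
    congr 1
    push_cast
    rw [map_pow]; ring
  rw [h4, ← Complex.normSq_eq_norm_sq, Complex.normSq_sub, Complex.normSq_eq_norm_sq,
    Complex.normSq_eq_norm_sq, norm_pow, norm_pow, hk]
  ring

lemma neg_re_mul_inv_le {b : ℂ} (hb : ‖b‖ ≤ 1) {x : ℝ} (hx0 : 0 ≤ x) (hx1 : x < 1) :
    -(b * (1 - b * x)⁻¹).re ≤ (1 + x)⁻¹ := by
  have hss : b.re * b.re + b.im * b.im ≤ 1 := by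
    rw [← Complex.normSq_apply, Complex.normSq_eq_norm_sq]
    exact pow_le_one₀ (norm_nonneg _) hb
  have hu := abs_le.mp ((Complex.abs_re_le_norm b).trans hb)
  have hxb : ‖b * x‖ < 1 := by
    rw [norm_mul, Complex.norm_real, Real.norm_of_nonneg hx0]
    nlinarith [norm_nonneg b]
  have hD : 0 < Complex.normSq (1 - b * x) := Complex.normSq_pos.mpr fun h => by
    rw [← sub_eq_zero.mp h] at hxb; simp at hxb
  have hre : -(b * (1 - b * x)⁻¹).re =
      (x * (b.re * b.re + b.im * b.im) - b.re) / Complex.normSq (1 - b * x) := by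
    rw [Complex.mul_re, Complex.inv_re, Complex.inv_im]
    simp
    ring
  rw [hre, div_le_iff₀ hD, inv_mul_eq_div, le_div_iff₀ (by linarith), Complex.normSq_apply]
  simp
  -- With `u = Re b` and `s = |b|²`, the cleared inequality is `x (u + s) ≤ 1 + u`. It holds at `x =
  -- 0` and at `x = 1`, and is affine in `x`.
  rcases le_total 0 (b.re + (b.re * b.re + b.im * b.im)) with h | h
  · nlinarith [mul_le_mul_of_nonneg_right hx1.le h]
  · nlinarith [mul_nonneg hx0 (neg_nonneg.mpr h)]

/-- Only the sums compare, not the terms: those on the right vanish for odd `n`. In closed form the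
part depending on `‖d‖` alone grows with `‖d‖`, and the cross term is extremal when `k d̄ = -1`. -/
lemma tsum_enorm_sq_pow_sub_pow_le {k d : ℂ} (hk : ‖k‖ = 1) (hd : ‖d‖ ≤ 1) {r : ℝ} (hr0 : 0 ≤ r)
    (hr1 : r < 1) :
    ∑' n : ℕ, ‖k ^ (n + 1) - d ^ (n + 1)‖ₑ ^ 2 * ENNReal.ofReal r ^ (2 * n) ≤
      ∑' n : ℕ, ‖(1 : ℂ) ^ (n + 1) - (-1) ^ (n + 1)‖ₑ ^ 2 * ENNReal.ofReal r ^ (2 * n) := by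
  have hx0 : 0 ≤ r ^ 2 := by positivity
  have hx1 : r ^ 2 < 1 := by nlinarith
  have key : ∀ k d : ℂ, ‖k‖ = 1 → ‖d‖ ≤ 1 →
      ∑' n : ℕ, ‖k ^ (n + 1) - d ^ (n + 1)‖ₑ ^ 2 * ENNReal.ofReal r ^ (2 * n) =
      ENNReal.ofReal ((1 - r ^ 2)⁻¹ + ‖d‖ ^ 2 * (1 - ‖d‖ ^ 2 * r ^ 2)⁻¹ -
        2 * (k * conj d * (1 - k * conj d * (r ^ 2 : ℝ))⁻¹).re) := by
    intro k d hk hd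
    have h := hasSum_norm_sq_pow_sub_pow hk hd hx0 hx1
    rw [← h.tsum_eq, ENNReal.ofReal_tsum_of_nonneg (fun n => by positivity) h.summable]
    congr 1 with n
    rw [ENNReal.ofReal_mul (by positivity), ENNReal.ofReal_pow (norm_nonneg _), ofReal_norm,
      ENNReal.ofReal_pow hx0, ENNReal.ofReal_pow hr0, pow_mul]
  rw [key k d hk hd, key 1 (-1) norm_one (by simp)]
  refine ENNReal.ofReal_le_ofReal ?_
  have h1 := neg_re_mul_inv_le (b := k * conj d) (by simpa [hk] using hd) hx0 hx1
  have hd2 : ‖d‖ ^ 2 ≤ 1 := pow_le_one₀ (norm_nonneg _) hd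
  have h2 : ‖d‖ ^ 2 * (1 - ‖d‖ ^ 2 * r ^ 2)⁻¹ ≤ 1 * (1 - 1 * r ^ 2)⁻¹ := by
    have : ‖d‖ ^ 2 * r ^ 2 ≤ 1 * r ^ 2 := by gcongr
    exact mul_le_mul hd2 (inv_anti₀ (by linarith) (by linarith)) (inv_nonneg.mpr (by linarith))
      zero_le_one
  have h3 : ((1 : ℂ) * conj (-1) * (1 - 1 * conj (-1) * (r ^ 2 : ℝ))⁻¹).re = -(1 + r ^ 2)⁻¹ := by
    have : ((1 : ℂ) * conj (-1) * (1 - 1 * conj (-1) * (r ^ 2 : ℝ))⁻¹) =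
        ((-(1 + r ^ 2)⁻¹ : ℝ) : ℂ) := by
      simp
    rw [this, Complex.ofReal_re]
  rw [h3]
  simp only [norm_neg, norm_one, one_pow]
  linarith

lemma hasSum_pow_succ_sub_pow_succ {k d z : ℂ} (hk : ‖k‖ ≤ 1) (hd : ‖d‖ ≤ 1) (hz : z ∈ disc) :
    HasSum (fun n => (k ^ (n + 1) - d ^ (n + 1)) * z ^ n) (k / (1 - k * z) - d / (1 - d * z)) := by
  have hgeo : ∀ c : ℂ, ‖c‖ ≤ 1 → HasSum (fun n => c * (c * z) ^ n) (c / (1 - c * z)) := by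
    intro c hc
    rw [div_eq_mul_inv]
    refine (hasSum_geometric_of_norm_lt_one ?_).mul_left c
    rw [norm_mul]
    rw [mem_disc] at hz
    nlinarith [norm_nonneg z, norm_nonneg c]
  convert! (hgeo k hk).sub (hgeo d hd) using 2 with n
  ring

/-- The rotation averages of `|k / (1 - k z) - d / (1 - d z)|²` are largest for antipodal poles on
the unit circle. -/
lemma lintegral_two_poles_le {k d : ℂ} (hk : ‖k‖ = 1) (hd : ‖d‖ ≤ 1) {V : ℝ → ℝ≥0∞}
    (hV : Measurable V) :
    ∫⁻ z, ‖k / (1 - k * z) - d / (1 - d * z)‖ₑ ^ 2 * V ‖z‖ ∂areaMeasure ≤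
      ∫⁻ z, ‖2 / (1 - z ^ 2)‖ₑ ^ 2 * V ‖z‖ ∂areaMeasure := by
  have hne : ∀ c : ℂ, ‖c‖ ≤ 1 → ∀ z ∈ disc, 1 - c * z ≠ 0 := fun c hc z hz => by
    rw [mul_comm]; exact one_sub_mul_ne_zero (mem_disc.mp hz) hc
  have hcont : ∀ k d : ℂ, ‖k‖ ≤ 1 → ‖d‖ ≤ 1 →
      ContinuousOn (fun z => k / (1 - k * z) - d / (1 - d * z)) disc := fun k d hk hd =>
    (ContinuousOn.div (by fun_prop) (by fun_prop) (hne k hk)).sub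
      (ContinuousOn.div (by fun_prop) (by fun_prop) (hne d hd))
  have hlog : ∀ z ∈ disc, (2 / (1 - z ^ 2) : ℂ) = 1 / (1 - 1 * z) - -1 / (1 - -1 * z) := by
    intro z hz
    have h1 := hne 1 (by simp) z hz
    have h2 := hne (-1) (by simp) z hz
    rw [div_sub_div _ _ h1 h2]
    congr 1 <;> ring
  have hrhs : ∫⁻ z, ‖2 / (1 - z ^ 2)‖ₑ ^ 2 * V ‖z‖ ∂areaMeasure =
      ∫⁻ z, ‖1 / (1 - 1 * z) - -1 / (1 - -1 * z)‖ₑ ^ 2 * V ‖z‖ ∂areaMeasure :=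
    lintegral_areaMeasure_congr fun z hz => by rw [hlog z hz]
  rw [hrhs, lintegral_sq_mul_radial (hcont k d hk.le hd)
      (fun z hz => hasSum_pow_succ_sub_pow_succ hk.le hd hz) hV,
    lintegral_sq_mul_radial (hcont 1 (-1) (by simp) (by simp))
      (fun z hz => hasSum_pow_succ_sub_pow_succ (by simp) (by simp) hz) hV]
  refine mul_le_mul_right (setLIntegral_mono' measurableSet_Ioo fun r hr => ?_) _
  exact mul_le_mul_right (tsum_enorm_sq_pow_sub_pow_le hk hd hr.1.le hr.2) _

/-- The logarithmic derivative of `1 - ψ`, for a Möbius automorphism `ψ` of the disc. -/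
lemma deriv_mob_div_one_sub_mob {η a : ℂ} (hη : ‖η‖ = 1) (ha : ‖a‖ < 1) :
    ∃ k : ℂ, ‖k‖ = 1 ∧ ∀ z ∈ disc, η * (1 - a * conj a) / (1 - conj a * z) ^ 2 / (1 - mob η a z) =
      k / (1 - k * z) - conj a / (1 - conj a * z) := by
  have h1 := mul_conj_of_norm_eq_one hη
  have hp : 1 + η * a ≠ 0 := by
    have := one_sub_mul_ne_zero (a := -a) (z := η) (by simpa using ha) hη.le
    convert! this using 1; ring
  have hq : conj a + η = η * conj (1 + η * a) := by
    simp only [map_add, map_mul, map_one]; linear_combination -conj a * h1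
  have hk : ‖(conj a + η) / (1 + η * a)‖ = 1 := by
    rw [hq, norm_div, norm_mul, RCLike.norm_conj, hη, one_mul, div_self (by simpa using hp)]
  -- The inverse of this `k` is the point of the unit circle where `mob η a` takes the value `1`.
  refine ⟨(conj a + η) / (1 + η * a), hk, fun z hz => ?_⟩
  have hz' := mem_disc.mp hz
  have h2 : 1 - conj a * z ≠ 0 := one_sub_conj_mul_ne_zero ha hz'.le
  have h3 : 1 - (conj a + η) / (1 + η * a) * z ≠ 0 := by
    rw [mul_comm]; exact one_sub_mul_ne_zero hz' hk.le
  have h4 : (1 + η * a) - (conj a + η) * z ≠ 0 := by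
    have : (1 + η * a) - (conj a + η) * z = (1 + η * a) * (1 - (conj a + η) / (1 + η * a) * z) := by
      field_simp
    rw [this]; exact mul_ne_zero hp h3
  have h5 : 1 - mob η a z = ((1 + η * a) - (conj a + η) * z) / (1 - conj a * z) := by
    rw [mob, eq_div_iff h2, sub_mul, mul_assoc, div_mul_cancel₀ _ h2]; ring
  have h6 : (conj a + η) / (1 + η * a) / (1 - (conj a + η) / (1 + η * a) * z) =
      (conj a + η) / ((1 + η * a) - (conj a + η) * z) := by
    rw [div_div, mul_sub, mul_one, ← mul_assoc, mul_div_cancel₀ _ hp]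
  have h7 : (1 - conj a * z) ^ 2 * (((1 + η * a) - (conj a + η) * z) / (1 - conj a * z)) =
      ((1 + η * a) - (conj a + η) * z) * (1 - conj a * z) := by
    rw [pow_two, mul_assoc, mul_div_cancel₀ _ h2, mul_comm]
  rw [h5, h6, div_sub_div _ _ h4 h2, div_div, h7]
  congr 1
  ring

/-- Substituting the inverse of `φ` makes the integrand the logarithmic derivative of `1 - ψ`, a
difference of two simple poles, while the weight becomes the radial function `potential μ`. -/
lemma lintegral_inv_one_sub_mul_potential_le {μ : Measure ℂ} [SFinite (μ.restrict disc)]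
    (hμ : IsRadial μ) {φ : ℂ → ℂ} (hφ : IsAut φ) :
    ∫⁻ w, ‖1 / (1 - w)‖ₑ ^ 2 * potential μ (φ w) ∂areaMeasure ≤
      ∫⁻ z, ‖2 / (1 - z ^ 2)‖ₑ ^ 2 * potential μ z ∂areaMeasure := by
  obtain ⟨η, a, hη, ha, hφm⟩ := hφ.exists_eq_mob
  have hη' : ‖conj η‖ = 1 := by simpa using hη
  have ha' : ‖-(η * a)‖ < 1 := by simpa [hη] using ha
  have haut := isAut_mob hη' ha'
  obtain ⟨k, hk, hlog⟩ := deriv_mob_div_one_sub_mob hη' ha'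
  have hV : Measurable fun r : ℝ => potential μ (r : ℂ) :=
    measurable_potential.comp Complex.measurable_ofReal
  have h := lintegral_two_poles_le hk (d := conj (-(η * a)))
    (by rw [RCLike.norm_conj]; exact ha'.le) hV
  rw [lintegral_comp_aut haut (fun z hz => hasDerivAt_mob ha' hz)]
  refine le_trans (le_of_eq (lintegral_areaMeasure_congr fun z hz => ?_))
    (h.trans_eq (lintegral_areaMeasure_congr fun z _ => ?_))
  · rw [hφm _ (haut.2.mapsTo hz), mob_mob' hη ha hz, ← potential_eq_norm hμ, ← hlog z hz,
      ← mul_assoc, ← mul_pow, ← enorm_mul, mul_one_div]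
  · rw [← potential_eq_norm hμ]

/-! ### The Cesàro operator as a primitive. -/

/-- Taylor coefficients are determined by the power series expansion. -/
lemma taylorCoeff_eq_of_hasSum {F : ℂ → ℂ} (hF : Hol F) {a : ℕ → ℂ}
    (ha : ∀ z ∈ disc, HasSum (fun n => a n * z ^ n) (F z)) (n : ℕ) : taylorCoeff F n = a n := by
  have key : ∀ b : ℕ → ℂ, (∀ z ∈ disc, HasSum (fun n => b n * z ^ n) (F z)) →
      HasFPowerSeriesAt F (FormalMultilinearSeries.ofScalars ℂ b) 0 := by
    intro b hb
    rw [hasFPowerSeriesAt_iff]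
    filter_upwards [isOpen_disc.mem_nhds zero_mem_disc] with z hz
    rw [zero_add]
    convert! hb z hz using 2 with n
    simp [FormalMultilinearSeries.coeff_ofScalars, mul_comm]
  have h := (key _ fun z hz => hasSum_taylorCoeff hF hz).eq_formalMultilinearSeries (key a ha)
  have h2 := congrArg (fun p => p.coeff n) h
  simpa [FormalMultilinearSeries.coeff_ofScalars] using h2

lemma one_sub_ne_zero_of_mem_disc {z : ℂ} (hz : z ∈ disc) : 1 - z ≠ 0 := by
  rintro h
  rw [mem_disc, ← sub_eq_zero.mp h] at hz
  simp at hz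

lemma hol_div_one_sub {f : ℂ → ℂ} (hf : Hol f) : Hol (fun z => f z / (1 - z)) :=
  hf.div (by fun_prop) fun _ hz => one_sub_ne_zero_of_mem_disc hz

/-- Cauchy product with the geometric series. -/
lemma taylorCoeff_div_one_sub {f : ℂ → ℂ} (hf : Hol f) (n : ℕ) :
    taylorCoeff (fun z => f z / (1 - z)) n = ∑ k ∈ Finset.range (n + 1), taylorCoeff f k := by
  refine taylorCoeff_eq_of_hasSum (a := fun n => ∑ k ∈ Finset.range (n + 1), taylorCoeff f k)
    (hol_div_one_sub hf) (fun z hz => ?_) n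
  have h1 := hasSum_taylorCoeff hf hz
  have hz' := mem_disc.mp hz
  have h2 := hasSum_geometric_of_norm_lt_one hz'
  have h := hasSum_sum_range_mul_of_summable_norm h1.summable.norm h2.summable.norm
  rw [h1.tsum_eq, h2.tsum_eq, ← div_eq_mul_inv] at h
  convert! h using 2 with m
  rw [Finset.sum_mul]
  refine Finset.sum_congr rfl fun k hk => ?_
  rw [mul_assoc, ← pow_add, Nat.add_sub_cancel' (Nat.lt_succ_iff.mp (Finset.mem_range.mp hk))]

lemma cesaro_zero (f : ℂ → ℂ) : cesaro f 0 = f 0 := by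
  rw [cesaro, tsum_eq_single 0 fun n hn => by simp [hn]]
  simp [taylorCoeff_zero]

/-- The function `z ↦ z C(f)(z)` is a primitive of `f(z) / (1 - z)`. -/
lemma exists_primitive_eq_mul_cesaro {f : ℂ → ℂ} (hf : Hol f) :
    ∃ h : ℂ → ℂ, (∀ z ∈ disc, HasDerivAt h (f z / (1 - z)) z) ∧
      (∀ z ∈ disc, h z = z * cesaro f z) ∧ Hol (cesaro f) := by
  have hF := hol_div_one_sub hf
  obtain ⟨h, h0, hd⟩ :=
    (DifferentiableOn.isExactOn_ball (c := 0) (r := 1) hF).with_val_at 0 0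
  have hd' : ∀ z ∈ disc, HasDerivAt h (f z / (1 - z)) z := hd
  have hh : Hol h := fun z hz => (hd' z hz).differentiableAt.differentiableWithinAt
  have heq : deriv h =ᶠ[𝓝 0] fun z => f z / (1 - z) := by
    filter_upwards [isOpen_disc.mem_nhds zero_mem_disc] with z hz
    exact (hd' z hz).deriv
  have hcoef : ∀ n : ℕ, taylorCoeff h (n + 1) =
      1 / ((n : ℂ) + 1) * ∑ k ∈ Finset.range (n + 1), taylorCoeff f k := by
    intro n
    have h1 := taylorCoeff_deriv h n
    rw [taylorCoeff, heq.iteratedDeriv_eq, ← taylorCoeff, taylorCoeff_div_one_sub hf] at h1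
    rw [h1]
    field_simp [Nat.cast_add_one_ne_zero n]
  have hmul : ∀ z ∈ disc, h z = z * cesaro f z := by
    intro z hz
    have hs := hasSum_taylorCoeff hh hz
    rw [← hs.tsum_eq, hs.summable.tsum_eq_zero_add, taylorCoeff_zero, h0, zero_mul, zero_add,
      cesaro, ← tsum_mul_left]
    refine tsum_congr fun n => ?_
    rw [hcoef]; ring
  refine ⟨h, hd', hmul, ?_⟩
  -- `cesaro f` is `h z / z` with its removable singularity filled, which is what `dslope` provides.
  refine DifferentiableOn.congr (f := dslope h 0) ?_ fun z hz => ?_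
  · exact (Complex.differentiableOn_dslope (isOpen_disc.mem_nhds zero_mem_disc)).mpr hh
  · rcases eq_or_ne z 0 with rfl | hz0
    · rw [dslope_same, (hd' 0 zero_mem_disc).deriv, cesaro_zero]; simp
    · rw [dslope_of_ne _ hz0, slope_def_field, h0, hmul z hz, sub_zero, sub_zero,
        mul_div_cancel_left₀ _ hz0]

lemma deriv_cesaro {f : ℂ → ℂ} (hf : Hol f) {z : ℂ} (hz : z ∈ disc) (hz0 : z ≠ 0) :
    deriv (cesaro f) z = (f z / (1 - z) - cesaro f z) / z := by
  obtain ⟨h, hd, hmul, hC⟩ := exists_primitive_eq_mul_cesaro hf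
  have h1 := (hasDerivAt_id z).mul (hC.hasDerivAt hz)
  have h2 : h =ᶠ[𝓝 z] id * CesaroNorm.cesaro f := by
    filter_upwards [isOpen_disc.mem_nhds hz] with w hw
    exact hmul w hw
  have h3 := (h1.congr_of_eventuallyEq h2).unique (hd z hz)
  rw [← h3]
  simp only [id]
  field_simp
  ring

/-! ### The image of the constant `1` and its behaviour at the boundary point `1`. -/

lemma mul_cesaro_one {z : ℂ} (hz : z ∈ disc) : z * cesaro (fun _ => 1) z = -log (1 - z) := by
  have hc : ∀ n : ℕ, ∑ k ∈ Finset.range (n + 1), taylorCoeff (fun _ => (1 : ℂ)) k = 1 := by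
    intro n
    rw [Finset.sum_eq_single_of_mem 0 (by simp)]
    · simp [taylorCoeff]
    · intro k _ hk
      simp [taylorCoeff, iteratedDeriv_const, hk]
  have h := Complex.hasSum_taylorSeries_neg_log (mem_disc.mp hz)
  rw [← h.tsum_eq, h.summable.tsum_eq_zero_add, cesaro, ← tsum_mul_left]
  simp only [hc]
  simp only [pow_zero, Nat.cast_zero, div_zero, zero_add]
  refine tsum_congr fun n => ?_
  push_cast
  ring

lemma tendsto_mul_log_zero : Tendsto (fun u : ℂ => u * log u) (𝓝 0) (𝓝 0) := by
  have hb : ∀ u : ℂ, ‖u * log u‖ ≤ |‖u‖ * Real.log ‖u‖| + Real.pi * ‖u‖ := by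
    intro u
    have h1 : ‖log u‖ ≤ |Real.log ‖u‖| + Real.pi := by
      refine (Complex.norm_le_abs_re_add_abs_im _).trans ?_
      rw [Complex.log_re, Complex.log_im]
      gcongr
      exact Complex.abs_arg_le_pi u
    rw [norm_mul, abs_mul, abs_of_nonneg (norm_nonneg u)]
    nlinarith [mul_le_mul_of_nonneg_left h1 (norm_nonneg u)]
  refine squeeze_zero_norm hb ?_
  have hc : Continuous fun u : ℂ => |‖u‖ * Real.log ‖u‖| + Real.pi * ‖u‖ := by
    have := Real.continuous_mul_log.comp (continuous_norm (E := ℂ))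
    simp only [Function.comp_def] at this
    fun_prop
  simpa using hc.tendsto 0

lemma hol_one : Hol (fun _ => 1) := differentiableOn_const 1

/-- From `cesaro 1 = -log (1 - w) / w` the product is `(1 + (1 - w) log (1 - w) / w) / w`, and `u
log u → 0`. -/
lemma tendsto_one_sub_mul_deriv_cesaro_one :
    Tendsto (fun w => (1 - w) * deriv (cesaro fun _ => 1) w) (𝓝[disc] 1) (𝓝 1) := by
  have h1 : Tendsto (fun w : ℂ => 1 - w) (𝓝[disc] 1) (𝓝 0) := by
    have : Continuous fun w : ℂ => 1 - w := by fun_prop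
    simpa using (this.tendsto 1).mono_left nhdsWithin_le_nhds
  have hid : Tendsto (fun w : ℂ => w) (𝓝[disc] 1) (𝓝 1) := tendsto_id.mono_left nhdsWithin_le_nhds
  have h2 := tendsto_mul_log_zero.comp h1
  have h3 := ((h2.div hid one_ne_zero).const_add 1).div hid one_ne_zero
  simp only [add_zero, div_one] at h3
  refine h3.congr' ?_
  filter_upwards [self_mem_nhdsWithin, nhdsWithin_le_nhds (isOpen_ne.mem_nhds one_ne_zero)]
    with w hw hw0
  have hw1 := one_sub_ne_zero_of_mem_disc hw
  have h5 : cesaro (fun _ => 1) w = -log (1 - w) / w := by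
    rw [← mul_cesaro_one hw, mul_div_cancel_left₀ _ hw0]
  rw [deriv_cesaro hol_one hw hw0, h5]
  simp only [Function.comp_apply, Pi.div_apply]
  field_simp
  ring

lemma normHInf_one_le : normHInf (fun _ => 1) ≤ 1 := iSup₂_le fun _ _ => by simp

lemma enorm_le_one_of_normHInf_le {f : ℂ → ℂ} (hf : normHInf f ≤ 1) {z : ℂ} (hz : z ∈ disc) :
    ‖f z‖ₑ ≤ 1 := (le_iSup₂ (f := fun z _ => ‖f z‖ₑ) z hz).trans hf

/-- If the potential were `∞` on the whole disc, the image of `1` would have infinite norm, since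
its derivative is nonzero on a nonempty open set near `1`. -/
lemma exists_potential_lt_top {μ : Measure ℂ} (hb : IsBoundedOp μ cesaro) :
    ∃ z ∈ disc, potential μ z < ⊤ := by
  by_contra! hcon
  obtain ⟨K, hK⟩ := hb
  have hM := (hK (fun _ => 1) ⟨hol_one, normHInf_one_le.trans_lt ENNReal.one_lt_top⟩).1.2
  have hid : IsAut id := ⟨differentiableOn_id, bijOn_id _⟩
  have h1 := (le_iSup (fun φ : {φ : ℂ → ℂ // IsAut φ} =>
    (∫⁻ w, ‖deriv (cesaro fun _ => 1) w‖ₑ ^ 2 * potential μ (φ.1 w) ∂areaMeasure) ^ (1 / 2 : ℝ))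
      ⟨id, hid⟩).trans_lt (le_add_self.trans_lt hM)
  rw [ENNReal.rpow_lt_top_iff_of_pos (by norm_num)] at h1
  have h2 : ∀ᶠ w in 𝓝[disc] (1 : ℂ), deriv (cesaro fun _ => 1) w ≠ 0 :=
    (tendsto_one_sub_mul_deriv_cesaro_one.eventually_ne one_ne_zero).mono
      fun w hw h => hw (by rw [h, mul_zero])
  obtain ⟨U, hUo, h1U, hU⟩ := mem_nhdsWithin.mp h2
  have hSo : IsOpen (U ∩ disc) := hUo.inter isOpen_disc
  have hne : (U ∩ disc).Nonempty := by
    have : (1 : ℂ) ∈ closure disc := by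
      rw [disc, closure_ball _ one_ne_zero]; simp
    exact mem_closure_iff.mp this U hUo h1U
  have hpos := hSo.measure_pos volume hne
  refine h1.ne (top_le_iff.mp ?_)
  rw [lintegral_areaMeasure]
  calc (⊤ : ℝ≥0∞) = ENNReal.ofReal Real.pi⁻¹ * (⊤ * volume (U ∩ disc)) := by
        rw [ENNReal.top_mul hpos.ne', ENNReal.mul_top (by simp [Real.pi_pos])]
    _ = ENNReal.ofReal Real.pi⁻¹ * ∫⁻ w in U ∩ disc, ⊤ := by rw [setLIntegral_const]
    _ ≤ _ := by
        refine mul_le_mul_right ((setLIntegral_mono' hSo.measurableSet fun w hw => ?_).trans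
          (lintegral_mono_set inter_subset_right)) _
        have hp : potential μ w = ⊤ := top_le_iff.mp (hcon w hw.2)
        rw [show potential μ ((id : ℂ → ℂ) w) = ⊤ from hp, ENNReal.mul_top]
        have := hU hw
        simpa using this

/-! ### The upper and lower bounds. -/

lemma ofReal_four_div (z : ℂ) : ENNReal.ofReal (4 / ‖1 - z ^ 2‖ ^ 2) = ‖2 / (1 - z ^ 2)‖ₑ ^ 2 := by
  rw [← ofReal_norm, ← ENNReal.ofReal_pow (norm_nonneg _), norm_div, div_pow, Complex.norm_two]
  norm_num

lemma normM_cesaro_le {μ : Measure ℂ} [SFinite (μ.restrict disc)] (hμ : IsRadial μ) {f : ℂ → ℂ}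
    (hf : Hol f) (hf1 : normHInf f ≤ 1) :
    normM μ (cesaro f) ≤
      1 + (∫⁻ z, ‖2 / (1 - z ^ 2)‖ₑ ^ 2 * potential μ z ∂areaMeasure) ^ (1 / 2 : ℝ) := by
  obtain ⟨h, hd, hmul, hC⟩ := exists_primitive_eq_mul_cesaro hf
  refine add_le_add ?_ (iSup_le fun φ => ENNReal.rpow_le_rpow ?_ (by norm_num))
  · rw [cesaro_zero]; exact enorm_le_one_of_normHInf_le hf1 zero_mem_disc
  · refine (lintegral_deriv_sq_mul_potential_le hC hmul φ.2).trans
      (le_trans (lintegral_areaMeasure_mono fun w hw => ?_)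
        (lintegral_inv_one_sub_mul_potential_le hμ φ.2))
    rw [(hd w hw).deriv, div_eq_mul_one_div, enorm_mul]
    gcongr
    exact mul_le_of_le_one_left' (enorm_le_one_of_normHInf_le hf1 hw)

/-- For `ψ = (z + t) / (1 + t z)`, write `ψ' g'(ψ)` as `ψ' / (1 - ψ)` times `(1 - ψ) g'(ψ)`. The
first factor is `(1 + t) / ((1 + t z) (1 - z))`; the second tends to `1` because `ψ → 1`. -/
lemma tendsto_deriv_mob_mul_deriv_cesaro_one {t : ℕ → ℝ} (ht : ∀ n, t n ∈ Ioo (0 : ℝ) 1)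
    (ht1 : Tendsto t atTop (𝓝 1)) {z : ℂ} (hz : z ∈ disc) :
    Tendsto (fun n => (1 * (1 - -(t n : ℂ) * conj (-(t n : ℂ))) /
      (1 - conj (-(t n : ℂ)) * z) ^ 2) * deriv (cesaro fun _ => 1) (mob 1 (-(t n)) z)) atTop
      (𝓝 (2 / (1 - z ^ 2))) := by
  have hz' := mem_disc.mp hz
  have ht1' : Tendsto (fun n => (t n : ℂ)) atTop (𝓝 1) := by
    simpa [Function.comp_def] using (Complex.continuous_ofReal.tendsto 1).comp ht1
  have hzne : 1 + z ≠ 0 := by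
    have := one_sub_mul_ne_zero (a := z) (z := -1) hz' (by simp)
    convert! this using 1; ring
  have hz1 := one_sub_ne_zero_of_mem_disc hz
  have hden : Tendsto (fun n => 1 + t n * z) atTop (𝓝 (1 + z)) := by
    simpa using (ht1'.mul_const z).const_add 1
  have hψ1 : Tendsto (fun n => mob 1 (-(t n)) z) atTop (𝓝 1) := by
    have := ((ht1'.const_add z).div hden hzne)
    rw [add_comm z 1, div_self hzne] at this
    refine this.congr fun n => ?_
    simp [mob]
  have hψ : Tendsto (fun n => mob 1 (-(t n)) z) atTop (𝓝[disc] 1) :=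
    tendsto_nhdsWithin_iff.mpr ⟨hψ1, Eventually.of_forall fun n => mob_mem_disc norm_one
      (by simpa [abs_of_pos (ht n).1] using (ht n).2) hz⟩
  have h1 := tendsto_one_sub_mul_deriv_cesaro_one.comp hψ
  have h2 : Tendsto (fun n => (1 + (t n : ℂ)) / ((1 + t n * z) * (1 - z))) atTop
      (𝓝 (2 / (1 - z ^ 2))) := by
    have := (ht1'.const_add 1).div (hden.mul_const (1 - z)) (mul_ne_zero hzne hz1)
    convert! this using 2
    congr 1 <;> ring
  have h3 := h2.mul h1
  rw [mul_one] at h3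
  refine h3.congr fun n => ?_
  have hn0 : 1 - (t n : ℂ) ≠ 0 := by
    rw [sub_ne_zero]; exact_mod_cast (ht n).2.ne'
  have hn : 1 + t n * z ≠ 0 := by
    have := one_sub_mul_ne_zero (a := -(t n : ℂ)) (z := z)
      (by simpa [abs_of_pos (ht n).1] using (ht n).2) hz'.le
    convert! this using 1; ring
  have h4 : 1 - mob 1 (-(t n)) z = (1 - t n) * (1 - z) / (1 + t n * z) := by
    simp only [mob, map_neg, Complex.conj_ofReal]
    rw [show 1 - -(t n : ℂ) * z = 1 + t n * z by ring, one_mul, eq_div_iff hn, sub_mul,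
      div_mul_cancel₀ _ hn]
    ring
  simp only [Function.comp_apply]
  rw [← mul_assoc, h4]
  congr 1
  rw [map_neg, Complex.conj_ofReal, show 1 - -(t n : ℂ) * z = 1 + t n * z by ring]
  field_simp
  ring

lemma le_normM_cesaro_one {μ : Measure ℂ} [SFinite (μ.restrict disc)] :
    1 + (∫⁻ z, ‖2 / (1 - z ^ 2)‖ₑ ^ 2 * potential μ z ∂areaMeasure) ^ (1 / 2 : ℝ) ≤
      normM μ (cesaro fun _ => 1) := by
  set g := cesaro fun _ => 1 with hg
  refine add_le_add (by rw [hg, cesaro_zero]; simp) ?_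
  set S := ⨆ φ : {φ : ℂ → ℂ // IsAut φ},
    (∫⁻ w, ‖deriv g w‖ₑ ^ 2 * potential μ (φ.1 w) ∂areaMeasure) ^ (1 / 2 : ℝ) with hS
  obtain ⟨t, -, ht, ht1⟩ := exists_seq_strictMono_tendsto' (zero_lt_one (α := ℝ))
  have htn : ∀ n, ‖(t n : ℂ)‖ < 1 := fun n => by
    simpa [abs_of_pos (ht n).1] using (ht n).2
  have htn' : ∀ n, ‖-(t n : ℂ)‖ < 1 := fun n => by simpa using htn n
  set D : ℕ → ℂ → ℂ := fun n z => (1 * (1 - -(t n : ℂ) * conj (-(t n : ℂ))) /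
      (1 - conj (-(t n : ℂ)) * z) ^ 2) * deriv g (mob 1 (-(t n)) z) with hD
  have hI : ∀ n, ∫⁻ z, ‖D n z‖ₑ ^ 2 * potential μ z ∂areaMeasure ≤ S ^ (2 : ℝ) := by
    intro n
    have h1 : (∫⁻ w, ‖deriv g w‖ₑ ^ 2 * potential μ (mob 1 (t n) w) ∂areaMeasure) ^ (1 / 2 : ℝ) ≤ S :=
      le_iSup (fun φ : {φ : ℂ → ℂ // IsAut φ} =>
        (∫⁻ w, ‖deriv g w‖ₑ ^ 2 * potential μ (φ.1 w) ∂areaMeasure) ^ (1 / 2 : ℝ))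
        ⟨mob 1 (t n), isAut_mob norm_one (htn n)⟩
    have h2 := ENNReal.rpow_le_rpow h1 (zero_le_two (α := ℝ))
    rw [← ENNReal.rpow_mul, show (1 / 2 : ℝ) * 2 = 1 by norm_num, ENNReal.rpow_one,
      lintegral_comp_aut (isAut_mob norm_one (htn' n)) (fun z hz => hasDerivAt_mob (htn' n) hz)]
      at h2
    refine le_trans (le_of_eq (lintegral_areaMeasure_congr fun z hz => ?_)) h2
    have h3 := mob_mob' (η := 1) norm_one (htn n) hz
    rw [map_one, one_mul] at h3
    rw [h3, hD]
    simp only [enorm_mul _ (deriv g _)]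
    ring
  have hm : ∀ n, Measurable fun z => ‖D n z‖ₑ ^ 2 * potential μ z := by
    intro n
    have h1 := measurable_potential (μ := μ)
    have h2 := (measurable_deriv g).comp (measurable_mob 1 (-(t n)))
    simp only [Function.comp_def] at h2
    fun_prop
  have hF : ∫⁻ z, ‖2 / (1 - z ^ 2)‖ₑ ^ 2 * potential μ z ∂areaMeasure ≤ S ^ (2 : ℝ) := by
    calc _ ≤ ∫⁻ z, liminf (fun n => ‖D n z‖ₑ ^ 2 * potential μ z) atTop ∂areaMeasure := by
          refine lintegral_areaMeasure_mono fun z hz => ?_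
          have h1 := tendsto_deriv_mob_mul_deriv_cesaro_one ht ht1 hz
          have h2 : Tendsto (fun n => ‖D n z‖ₑ ^ 2) atTop (𝓝 (‖2 / (1 - z ^ 2)‖ₑ ^ 2)) :=
            ENNReal.Tendsto.pow h1.enorm
          -- The potential may be `∞` at `z`; a nonzero limit keeps multiplication by it continuous.
          have h0 : ‖2 / (1 - z ^ 2)‖ₑ ^ 2 ≠ 0 := by
            have h3 := one_sub_mul_ne_zero (a := z) (mem_disc.mp hz) (mem_disc.mp hz).le
            simp [pow_two, h3]
          exact (ENNReal.Tendsto.mul_const h2 (Or.inl h0)).liminf_eq.ge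
      _ ≤ liminf (fun n => ∫⁻ z, ‖D n z‖ₑ ^ 2 * potential μ z ∂areaMeasure) atTop :=
          lintegral_liminf_le hm
      _ ≤ S ^ (2 : ℝ) := liminf_le_of_frequently_le' (Frequently.of_forall hI)
  have h := ENNReal.rpow_le_rpow hF (by norm_num : (0 : ℝ) ≤ 1 / 2)
  rwa [← ENNReal.rpow_mul, show (2 : ℝ) * (1 / 2) = 1 by norm_num, ENNReal.rpow_one] at h

end CesaroNorm

theorem theorem1p4 (μ : Measure ℂ) (hdisc : μ CesaroNorm.discᶜ = 0)
    (hradial : CesaroNorm.IsRadial μ)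
    (hbdd : CesaroNorm.IsBoundedOp μ CesaroNorm.cesaro) :
    CesaroNorm.opNorm μ CesaroNorm.cesaro =
      1 + (∫⁻ z, ENNReal.ofReal (4 / ‖1 - z ^ 2‖ ^ 2) * CesaroNorm.potential μ z
            ∂CesaroNorm.areaMeasure) ^ (1 / 2 : ℝ) := by
  obtain ⟨z₀, hz₀, hlt⟩ := CesaroNorm.exists_potential_lt_top hbdd
  have := CesaroNorm.sigmaFinite_of_potential_lt_top hz₀ hlt
  simp only [CesaroNorm.ofReal_four_div]
  refine le_antisymm (iSup_le fun f => CesaroNorm.normM_cesaro_le hradial f.2.1 f.2.2) ?_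
  exact CesaroNorm.le_normM_cesaro_one.trans
    (le_iSup (fun f : {f : ℂ → ℂ // CesaroNorm.Hol f ∧ CesaroNorm.normHInf f ≤ 1} =>
      CesaroNorm.normM μ (CesaroNorm.cesaro f.1))
      ⟨fun _ => 1, CesaroNorm.hol_one, CesaroNorm.normHInf_one_le⟩)
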